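/- Let $\varepsilon>0$ and let $S_\varepsilon=\{\mathbf x\in\mathbb R^3: 1-\varepsilon<\|\mathbf x\|<1+\varepsilon\}$. For $\nu>0$, $a>0$ let $$M(r;\nu,a)=\frac{2^{1-\nu}}{\Gamma(\nu)}(ar)^\nu K_\nu(ar)\quad(r>0),\qquad M(0;\nu,a)=1,$$ be the Matérn function, where $K_\nu$ is the modified Bessel function of the second kind. Let $Z=(Z(\mathbf s))_{\mathbf s\in S_\varepsilon}$ be a real Gaussian random field on a probability space $(\Omega,\mathcal F,\mathbb P)$ with mean zero and covariance $\mathrm{Cov}(Z(\mathbf s),Z(\mathbf t))=C_1(\|\mathbf s-\mathbf t\|)$ for all $\mathbf s,\mathbf t\in S_\varepsilon$, where $C_1(r)=M(r;\nu,a)$. Consider the following conditions. **A1.** $Z$ is differentiable in quadratic mean on $S_\varepsilon$, that is, for $i=1,2,3$ there is a random field $D^{(i)}_{\mathrm{qm}}Z$ on $S_\varepsilon$ such that, for every $\mathbf s\in S_\varepsilon$, $\mathbb E\big(\tfrac{Z(\mathbf s+h\mathbf e_i)-Z(\mathbf s)}{h}-D^{(i)}_{\mathrm{qm}}Z(\mathbf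 s)\big)^2\to0$ as $h\to0$. Moreover, there is a random field $\widetilde Z$ on $S_\varepsilon$ with $\mathbb P(\widetilde Z(\mathbf s)=Z(\mathbf s))=1$ for every $\mathbf s\in S_\varepsilon$, whose sample paths are almost surely continuously differentiable on $S_\varepsilon$, and whose sample partial derivatives satisfy, for every $\mathbf s\in S_\varepsilon$ and every $i$, $D^{(i)}\widetilde Z(\mathbf s)=D^{(i)}_{\mathrm{qm}}Z(\mathbf s)$ almost surely. **A2.** $Z$ is (second-order) stationary, with a covariance function $C(\mathbf h)$, $\mathbf h=\mathbf s-\mathbf t$, that is twice continuously differentiable on $\{\mathbf s-\mathbf t:\mathbf s,\mathbf t\in S_\varepsilon\}$. Then A1 and A2 both hold if and only if $\nu>1$. Moreover, if $\nu>1$, then $C_1$ is twice continuously differentiable on $[0,\infty)$ (with one-sided derivatives at $0$), $\mathbf h\mapsto C_1(\|\mathbf h\|)$ is twice continuously differentiable on $\mathbb R^3$, and its Hessian at the origin is $$\nabla_{\mathbf h}\nabla_{\mathbf h}^{\mathrm T}C_1(\|\mathbf h\|)\Big|_{\mathbf h=\mathbf 0}=F(0)\,\mathbf I_3,\qquad F(0)=C_1''(0)=-\frac{a^2}{2(\nu-1)},$$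 where $F(r)=C_1'(r)/r$ for $r>0$ and $F(0)=C_1''(0)$. -/

import Mathlib

open MeasureTheory ProbabilityTheory Filter Topology

namespace MaternField

/-- Euclidean three-space. -/
abbrev E3 : Type := EuclideanSpace ℝ (Fin 3)

/-- The `i`-th standard unit vector of `ℝ³`. -/
noncomputable def e (i : Fin 3) : E3 := EuclideanSpace.single i (1 : ℝ)

/-- The spherical shell `{x ∈ ℝ³ : 1 - ε < ‖x‖ < 1 + ε}`. -/
def shell (ε : ℝ) : Set E3 := {x | 1 - ε < ‖x‖ ∧ ‖x‖ < 1 + ε}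

/-- The separation vectors `s - t` of pairs of points of `S`. -/
def lags (S : Set E3) : Set E3 := {h | ∃ s ∈ S, ∃ t ∈ S, h = s - t}

/-- The modified Bessel function of the second kind `K_ν(x)`, for `x > 0`, by
`K_ν(x) = ∫₀^∞ exp(-x cosh t) cosh(ν t) dt`. -/
noncomputable def besselK (ν x : ℝ) : ℝ :=
  ∫ t in Set.Ioi (0 : ℝ), Real.exp (-x * Real.cosh t) * Real.cosh (ν * t)

/-- The Matérn correlation function
`M(r; ν, a) = 2^{1-ν} / Γ(ν) * (a r)^ν * K_ν(a r)` for `r > 0`, with its limiting value `1`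
at `r = 0` (where `K_ν` is infinite). -/
noncomputable def matern (ν a r : ℝ) : ℝ :=
  if r = 0 then 1
  else (2 : ℝ) ^ (1 - ν) / Real.Gamma ν * (a * r) ^ ν * besselK ν (a * r)

section Fields

variable {Ω : Type*} [MeasurableSpace Ω]

/-- The random field `D` is, on `S`, the partial derivative of `Z` in quadratic mean along the
`i`-th coordinate direction: at each `s ∈ S`, `(Z(s + h eᵢ) - Z(s)) / h → D(s)` in `L²(P)` as
`h → 0`, `h ≠ 0`. (For open `S` only values of `Z` on `S` matter.) -/
def IsQMPartialDeriv (P : Measure Ω) (S : Set E3) (Z : E3 → Ω → ℝ) (i : Fin 3)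
    (D : E3 → Ω → ℝ) : Prop :=
  ∀ s ∈ S, Measurable (D s) ∧
    Tendsto (fun h : ℝ => eLpNorm (fun ω => (Z (s + h • e i) ω - Z s ω) / h - D s ω) 2 P)
      (𝓝[≠] 0) (𝓝 0)

/-- `Z'` is a version of `Z` on `S` with almost surely continuously differentiable paths. -/
structure IsSampleC1Version (P : Measure Ω) (S : Set E3) (Z' Z : E3 → Ω → ℝ) : Prop where
  measurable : ∀ s ∈ S, Measurable (Z' s)
  version : ∀ s ∈ S, ∀ᵐ ω ∂P, Z' s ω = Z s ω
  contDiffOn : ∀ᵐ ω ∂P, ContDiffOn ℝ 1 (fun s => Z' s ω) S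

/-- Condition A1: `Z` is differentiable in quadratic mean on `S`, and has an almost surely sample
continuously differentiable version whose sample partial derivatives agree almost surely, at each
point, with the partial derivatives of `Z` in quadratic mean. -/
def ConditionA1 (P : Measure Ω) (S : Set E3) (Z : E3 → Ω → ℝ) : Prop :=
  ∃ D : Fin 3 → E3 → Ω → ℝ, (∀ i, IsQMPartialDeriv P S Z i (D i)) ∧
    ∃ Z' : E3 → Ω → ℝ, IsSampleC1Version P S Z' Z ∧
      ∀ i, ∀ s ∈ S, ∀ᵐ ω ∂P, HasLineDerivAt ℝ (fun x => Z' x ω) (D i s ω) s (e i)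

/-- `Z` is stationary on `S` with covariance function `C`: it has finite second moments, constant
mean, and `Cov(Z(s), Z(t)) = C(s - t)` for all `s, t ∈ S`. -/
structure IsStationaryWith (P : Measure Ω) (S : Set E3) (Z : E3 → Ω → ℝ) (C : E3 → ℝ) :
    Prop where
  memLp : ∀ s ∈ S, MemLp (Z s) 2 P
  mean_const : ∃ m : ℝ, ∀ s ∈ S, ∫ ω, Z s ω ∂P = m
  cov_eq : ∀ s ∈ S, ∀ t ∈ S, cov[Z s, Z t; P] = C (s - t)

/-- Condition A2: `Z` is stationary on `S` with a covariance function that is twice continuously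
differentiable on the set of separation vectors of points of `S`. -/
def ConditionA2 (P : Measure Ω) (S : Set E3) (Z : E3 → Ω → ℝ) : Prop :=
  ∃ C : E3 → ℝ, IsStationaryWith P S Z C ∧ ContDiffOn ℝ 2 C (lags S)

end Fields

/-- The Hessian matrix `(∂²f / ∂hᵢ ∂hⱼ)` of `f` at `x`. -/
noncomputable def hessian (f : E3 → ℝ) (x : E3) : Matrix (Fin 3) (Fin 3) ℝ :=
  Matrix.of fun i j => lineDeriv ℝ (fun y => lineDeriv ℝ f y (e j)) x (e i)

/-- For `C₁ : [0, ∞) → ℝ`, the function `F(r) = C₁'(r) / r` for `r > 0` and `F(0) = C₁''(0)`;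
derivatives at `0` are one-sided. -/
noncomputable def radialF (C₁ : ℝ → ℝ) (r : ℝ) : ℝ :=
  if r = 0 then derivWithin (derivWithin C₁ (Set.Ici 0)) (Set.Ici 0) 0
  else derivWithin C₁ (Set.Ici 0) r / r

end MaternField

/-!
The Matérn function is a Gamma mixture of Gaussians, `M(r; ν, a) = E exp(-r² / (2V))` with `V` of
the Gamma distribution of shape `ν` and rate `a² / 2` (`matern_eq_integral`). Hence `h ↦ M(‖h‖)` is
the characteristic function of the law of `V ^ (-1/2) • N`, with `N` a standard Gaussian vector
independent of `V` (`maternSpectral`), and this spectral measure has a finite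
moment of order `q` exactly when `q < 2ν`. The theorem rests on this dichotomy for `q = 2`.

If `ν > 1`, the second moment is finite, so the characteristic function is twice continuously
differentiable, and its second derivative at `0` is minus the second moment
(`deriv_deriv_matern_abs`). If the covariance is twice continuously differentiable on the lags, then
`1 - M(r) = O(r²)`, and by Fatou's lemma `E (1 / V)` is finite, which forces `ν > 1`
(`one_lt_of_conditionA2`).

For the regularity of the field when `ν > 1`, the isometry `Z(s) ↦ exp(i ⟨·, s⟩)` into `L²` of the
spectral measure (`IsMaternField.integral_sq_sum`) turns a spectral moment of order `2 + 2α` into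
the `α`-Hölder continuity in `L²` of the difference quotients `(Z(s + h eᵢ) - Z(s)) / h`, jointly in
the base point `s` and the increment `h`. These quotients are Gaussian, so Kolmogorov's criterion, by
dyadic chaining (`ae_uniformContinuousOn_dyadicCube`), makes them almost surely uniformly continuous
on dyadic `(s, h)` with `h > 0`. Their continuous extension to `h = 0` is a continuous partial
derivative of the continuous extension of `Z` (`exists_contDiffOn_of_uniformContinuousOn`). Thus no
separate construction of the derivative fields is needed: the derivatives in quadratic mean are the
pointwise limits of the difference quotients, and Fatou's lemma gives the `L²` convergence
(`IsMaternField.tendsto_eLpNorm_quotient`).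
-/

namespace MaternField

/-! ### Integration against the Gamma distribution -/

theorem measurable_gammaPDF (ν ρ : ℝ) : Measurable (gammaPDF ν ρ) :=
  (measurable_gammaPDFReal ν ρ).ennreal_ofReal

theorem toReal_gammaPDF {ν ρ v : ℝ} (hν : 0 < ν) (hρ : 0 < ρ) (hv : 0 < v) :
    (gammaPDF ν ρ v).toReal = ρ ^ ν / Real.Gamma ν * (v ^ (ν - 1) * Real.exp (-(ρ * v))) := by
  rw [gammaPDF, ENNReal.toReal_ofReal (gammaPDFReal_nonneg hν hρ v), gammaPDFReal, if_pos hv.le]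
  ring

theorem integral_gammaMeasure {ν ρ : ℝ} (hν : 0 < ν) (hρ : 0 < ρ) (g : ℝ → ℝ) :
    ∫ v, g v ∂gammaMeasure ν ρ =
      ∫ v in Set.Ioi (0 : ℝ),
        ρ ^ ν / Real.Gamma ν * (v ^ (ν - 1) * Real.exp (-(ρ * v))) * g v := by
  rw [gammaMeasure, integral_withDensity_eq_integral_toReal_smul
    (measurable_gammaPDF ν ρ) (by simp [gammaPDF]),
    ← setIntegral_eq_integral_of_forall_compl_eq_zero (s := Set.Ici 0),
    integral_Ici_eq_integral_Ioi]
  · refine setIntegral_congr_fun measurableSet_Ioi fun v hv => ?_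
    simp only [toReal_gammaPDF hν hρ hv, smul_eq_mul]
  · intro v hv
    simp [gammaPDF_of_neg (not_le.1 hv)]

theorem integrable_gammaMeasure_iff {ν ρ : ℝ} (hν : 0 < ν) (hρ : 0 < ρ) (g : ℝ → ℝ) :
    Integrable g (gammaMeasure ν ρ) ↔
      IntegrableOn (fun v => v ^ (ν - 1) * Real.exp (-(ρ * v)) * g v) (Set.Ioi 0) := by
  rw [gammaMeasure, integrable_withDensity_iff_integrable_smul'
    (measurable_gammaPDF ν ρ) (by simp [gammaPDF]),
    ← integrableOn_iff_integrable_of_support_subset (s := Set.Ici 0),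
    integrableOn_Ici_iff_integrableOn_Ioi]
  · have h0 : ρ ^ ν / Real.Gamma ν ≠ 0 :=
      (div_pos (Real.rpow_pos_of_pos hρ _) (Real.Gamma_pos_of_pos hν)).ne'
    have : IntegrableOn (fun v => ρ ^ ν / Real.Gamma ν *
        (v ^ (ν - 1) * Real.exp (-(ρ * v)) * g v)) (Set.Ioi 0) ↔
        IntegrableOn (fun v => v ^ (ν - 1) * Real.exp (-(ρ * v)) * g v) (Set.Ioi 0) :=
      integrable_const_mul_iff (IsUnit.mk0 _ h0) _
    rw [← this]
    refine integrableOn_congr_fun (fun v hv => ?_) measurableSet_Ioi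
    simp only [toReal_gammaPDF hν hρ hv, smul_eq_mul]
    ring
  · intro v hv
    by_contra h
    exact hv (by simp [gammaPDF_of_neg (not_le.1 h)])

theorem ae_pos_gammaMeasure (ν ρ : ℝ) : ∀ᵐ v ∂gammaMeasure ν ρ, 0 < v := by
  have h : (gammaMeasure ν ρ) (Set.Iic 0) = 0 := by
    rw [gammaMeasure, withDensity_apply _ measurableSet_Iic]
    rw [setLIntegral_congr Iio_ae_eq_Iic.symm]
    exact lintegral_gammaPDF_of_nonpos le_rfl
  rw [ae_iff]
  convert h using 2
  ext v
  simp

theorem integrable_rpow_gammaMeasure {ν ρ q : ℝ} (hν : 0 < ν) (hρ : 0 < ρ) (hq : 0 < ν + q) :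
    Integrable (fun v => v ^ q) (gammaMeasure ν ρ) := by
  rw [integrable_gammaMeasure_iff hν hρ]
  have := integrableOn_rpow_mul_exp_neg_mul_rpow (p := 1) (s := ν + q - 1) (b := ρ)
    (by linarith) one_pos hρ
  refine this.congr_fun (fun v hv => ?_) measurableSet_Ioi
  have hv : 0 < v := hv
  simp only [Real.rpow_one]
  rw [show ν + q - 1 = (ν - 1) + q by ring, Real.rpow_add hv]
  ring_nf

/-- The mean of `1 / V` for a Gamma variable `V`. -/
theorem integral_inv_gammaMeasure {ν ρ : ℝ} (hν : 1 < ν) (hρ : 0 < ρ) :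
    ∫ v, v⁻¹ ∂gammaMeasure ν ρ = ρ / (ν - 1) := by
  rw [integral_gammaMeasure (by linarith) hρ]
  have h1 : ∫ v in Set.Ioi (0 : ℝ),
      ρ ^ ν / Real.Gamma ν * (v ^ (ν - 1) * Real.exp (-(ρ * v))) * v⁻¹ =
      ∫ v in Set.Ioi (0 : ℝ), ρ ^ ν / Real.Gamma ν *
        (v ^ ((ν - 1) - 1) * Real.exp (-(ρ * v))) := by
    refine setIntegral_congr_fun measurableSet_Ioi fun v hv => ?_
    have hv : 0 < v := hv
    rw [Real.rpow_sub_one hv.ne' (ν - 1)]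
    ring
  rw [h1, integral_const_mul, Real.integral_rpow_mul_exp_neg_mul_Ioi (by linarith) hρ]
  have h2 : Real.Gamma ν = (ν - 1) * Real.Gamma (ν - 1) := by
    conv_lhs => rw [show ν = (ν - 1) + 1 by ring]
    exact Real.Gamma_add_one (by linarith)
  have h3 : Real.Gamma (ν - 1) ≠ 0 := (Real.Gamma_pos_of_pos (by linarith)).ne'
  have h4 : ρ ^ ν = ρ ^ (ν - 1) * ρ := by
    rw [← Real.rpow_add_one hρ.ne']; ring_nf
  have h5 : ρ ^ (ν - 1) ≠ 0 := (Real.rpow_pos_of_pos hρ _).ne'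
  have h6 : ν - 1 ≠ 0 := by linarith
  rw [h2, h4, one_div, Real.inv_rpow hρ.le]
  field_simp

/-- For `ν ≤ 1` the mean of `1 / V` is infinite: `v ^ (ν - 2)` is not integrable at `0`. -/
theorem one_lt_of_integrable_inv_gammaMeasure {ν ρ : ℝ} (hν : 0 < ν) (hρ : 0 < ρ)
    (h : Integrable (fun v : ℝ => v⁻¹) (gammaMeasure ν ρ)) : 1 < ν := by
  rw [integrable_gammaMeasure_iff hν hρ] at h
  have h1 : IntegrableOn (fun v : ℝ => v ^ (ν - 1) * Real.exp (-(ρ * v)) * v⁻¹) (Set.Ioo 0 1) :=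
    h.mono_set Set.Ioo_subset_Ioi_self
  have h2 : IntegrableOn (fun v : ℝ => v ^ (ν - 2)) (Set.Ioo 0 1) := by
    refine Integrable.mono' (h1.const_mul (Real.exp ρ)) ?_ ?_
    · exact (measurable_id.pow_const _).aestronglyMeasurable
    · refine (ae_restrict_iff' measurableSet_Ioo).2 (ae_of_all _ fun v hv => ?_)
      have hv0 : 0 < v := hv.1
      rw [Real.norm_of_nonneg (Real.rpow_nonneg hv0.le _), show ν - 2 = ν - 1 - 1 by ring,
        Real.rpow_sub_one hv0.ne']
      have : 1 ≤ Real.exp ρ * Real.exp (-(ρ * v)) := by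
        rw [← Real.exp_add]
        exact Real.one_le_exp (by nlinarith [hv.2])
      calc v ^ (ν - 1) / v = 1 * (v ^ (ν - 1) / v) := (one_mul _).symm
        _ ≤ (Real.exp ρ * Real.exp (-(ρ * v))) * (v ^ (ν - 1) / v) := by gcongr
        _ = _ := by ring
  have := (intervalIntegral.integrableOn_Ioo_rpow_iff one_pos).1 h2
  linarith

/-! ### The Matérn function as a mixture of Gaussians -/

/-- The substitution `v = c eᵗ`, in the form needed for the Bessel integral. -/
theorem integral_comp_const_mul_exp {c : ℝ} (hc : 0 < c) (g : ℝ → ℝ) :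
    ∫ v in Set.Ioi (0 : ℝ), g v = ∫ t : ℝ, (c * Real.exp t) * g (c * Real.exp t) := by
  have hd : ∀ x ∈ (Set.univ : Set ℝ),
      HasDerivWithinAt (fun t => c * Real.exp t) (c * Real.exp x) Set.univ x := fun x _ =>
    ((Real.hasDerivAt_exp x).const_mul c).hasDerivWithinAt
  have hinj : Set.InjOn (fun t => c * Real.exp t) Set.univ := fun x _ y _ h =>
    Real.exp_injective (mul_left_cancel₀ hc.ne' h)
  have him : (fun t => c * Real.exp t) '' Set.univ = Set.Ioi 0 := by
    ext v
    simp only [Set.image_univ, Set.mem_range, Set.mem_Ioi]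
    constructor
    · rintro ⟨t, rfl⟩; positivity
    · intro hv
      exact ⟨Real.log (v / c), by rw [Real.exp_log (by positivity)]; field_simp⟩
  have := integral_image_eq_integral_abs_deriv_smul MeasurableSet.univ hd hinj g
  rw [him] at this
  rw [this, setIntegral_univ]
  refine integral_congr_ae (ae_of_all _ fun t => ?_)
  simp only [smul_eq_mul, abs_of_pos (mul_pos hc (Real.exp_pos t))]

theorem integrableOn_comp_const_mul_exp {c : ℝ} (hc : 0 < c) {g : ℝ → ℝ}
    (hg : IntegrableOn g (Set.Ioi 0)) :
    Integrable fun t : ℝ => (c * Real.exp t) * g (c * Real.exp t) := by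
  have hd : ∀ x ∈ (Set.univ : Set ℝ),
      HasDerivWithinAt (fun t => c * Real.exp t) (c * Real.exp x) Set.univ x := fun x _ =>
    ((Real.hasDerivAt_exp x).const_mul c).hasDerivWithinAt
  have hinj : Set.InjOn (fun t => c * Real.exp t) Set.univ := fun x _ y _ h =>
    Real.exp_injective (mul_left_cancel₀ hc.ne' h)
  have him : (fun t => c * Real.exp t) '' Set.univ ⊆ Set.Ioi 0 := by
    rintro _ ⟨t, -, rfl⟩
    exact mul_pos hc (Real.exp_pos t)
  have := (integrableOn_image_iff_integrableOn_abs_deriv_smul MeasurableSet.univ hd hinj g).1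
    (hg.mono_set him)
  rw [integrableOn_univ] at this
  refine this.congr (ae_of_all _ fun t => ?_)
  simp only [smul_eq_mul, abs_of_pos (mul_pos hc (Real.exp_pos t))]

/-- The Bessel integral as an integral of an exponential over the whole line. -/
theorem two_mul_besselK {ν x : ℝ}
    (hint : Integrable fun t : ℝ => Real.exp (-x * Real.cosh t) * Real.exp (ν * t)) :
    2 * besselK ν x = ∫ t : ℝ, Real.exp (-x * Real.cosh t) * Real.exp (ν * t) := by
  set A : ℝ → ℝ := fun t => Real.exp (-x * Real.cosh t) * Real.exp (ν * t) with hA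
  have h1 : ∫ t, A (-t) = ∫ t, A t := integral_neg_eq_self A volume
  have hint' : Integrable fun t => A (-t) := hint.comp_neg
  rw [besselK, ← integral_comp_abs
    (f := fun t => Real.exp (-x * Real.cosh t) * Real.cosh (ν * t))]
  have h2 : ∀ t : ℝ, Real.exp (-x * Real.cosh |t|) * Real.cosh (ν * |t|)
      = (A t + A (-t)) / 2 := by
    intro t
    have : Real.cosh (ν * |t|) = Real.cosh (ν * t) := by
      rw [← Real.cosh_abs (ν * |t|), ← Real.cosh_abs (ν * t), abs_mul, abs_mul, abs_abs]
    rw [this, Real.cosh_abs, Real.cosh_eq (ν * t)]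
    simp only [hA, Real.cosh_neg]
    ring_nf
  simp_rw [h2]
  rw [integral_div, integral_add hint hint', h1]
  ring

/-- The Matérn function is a scale mixture of Gaussians: `M(r; ν, a) = E exp(-r² / (2V))`, where
`V` has the Gamma distribution of shape `ν` and rate `a² / 2`. -/
theorem matern_eq_integral {ν a r : ℝ} (hν : 0 < ν) (ha : 0 < a) (hr : 0 ≤ r) :
    matern ν a r = ∫ v, Real.exp (-(r ^ 2 / (2 * v))) ∂gammaMeasure ν (a ^ 2 / 2) := by
  have hρ : 0 < a ^ 2 / 2 := by positivity
  have := isProbabilityMeasure_gammaMeasure hν hρ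
  rcases hr.eq_or_lt with rfl | hr
  · simp [matern]
  set ρ := a ^ 2 / 2 with hρd
  set c := r / a with hcd
  have hc : 0 < c := by positivity
  rw [integral_gammaMeasure hν hρ]
  have hI : IntegrableOn (fun v => ρ ^ ν / Real.Gamma ν * (v ^ (ν - 1) * Real.exp (-(ρ * v))) *
      Real.exp (-(r ^ 2 / (2 * v)))) (Set.Ioi 0) := by
    have h1 := integrableOn_rpow_mul_exp_neg_mul_rpow (p := 1) (s := ν - 1) (b := ρ)
      (by linarith) one_pos hρ
    refine Integrable.mono' (h1.const_mul (ρ ^ ν / Real.Gamma ν)) ?_ ?_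
    · refine Measurable.aestronglyMeasurable ?_
      fun_prop
    · refine (ae_restrict_iff' measurableSet_Ioi).2 (ae_of_all _ fun v hv => ?_)
      have hv : 0 < v := hv
      have hG := Real.Gamma_pos_of_pos hν
      rw [Real.norm_of_nonneg (by positivity)]
      simp only [Real.rpow_one, neg_mul]
      exact mul_le_of_le_one_right (by positivity) (Real.exp_le_one_iff.2 (by
        have : 0 ≤ r ^ 2 / (2 * v) := by positivity
        linarith))
  -- the integrand after `v = (r / a) eᵗ`
  have key : ∀ t : ℝ, (c * Real.exp t) * (ρ ^ ν / Real.Gamma ν *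
      ((c * Real.exp t) ^ (ν - 1) * Real.exp (-(ρ * (c * Real.exp t)))) *
      Real.exp (-(r ^ 2 / (2 * (c * Real.exp t))))) =
      (ρ ^ ν * c ^ ν / Real.Gamma ν) *
        (Real.exp (-(a * r) * Real.cosh t) * Real.exp (ν * t)) := by
    intro t
    have hct : 0 < c * Real.exp t := by positivity
    have e1 : (c * Real.exp t) * (c * Real.exp t) ^ (ν - 1) = c ^ ν * Real.exp (ν * t) := by
      rw [mul_comm, ← Real.rpow_add_one hct.ne', sub_add_cancel,
        Real.mul_rpow hc.le (Real.exp_pos t).le, ← Real.exp_mul, mul_comm t ν]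
    have e2 : Real.exp (-(ρ * (c * Real.exp t))) * Real.exp (-(r ^ 2 / (2 * (c * Real.exp t))))
        = Real.exp (-(a * r) * Real.cosh t) := by
      rw [← Real.exp_add, Real.cosh_eq, Real.exp_neg]
      congr 1
      have := Real.exp_pos t
      rw [hρd, hcd]
      field_simp
      ring
    rw [← e2]
    linear_combination (ρ ^ ν / Real.Gamma ν * Real.exp (-(ρ * (c * Real.exp t))) *
      Real.exp (-(r ^ 2 / (2 * (c * Real.exp t))))) * e1
  have hint := integrableOn_comp_const_mul_exp hc hI
  simp_rw [key] at hint
  have hG := Real.Gamma_pos_of_pos hν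
  have hk : (0 : ℝ) < ρ ^ ν * c ^ ν / Real.Gamma ν := by positivity
  rw [integrable_const_mul_iff (IsUnit.mk0 _ hk.ne')] at hint
  rw [integral_comp_const_mul_exp hc]
  simp_rw [key]
  rw [integral_const_mul, ← two_mul_besselK hint, matern, if_neg hr.ne']
  have e3 : ρ ^ ν * c ^ ν = (a * r) ^ ν * 2 ^ (-ν) := by
    rw [← Real.mul_rpow hρ.le hc.le, Real.rpow_neg (by norm_num), ← Real.inv_rpow (by norm_num),
      ← Real.mul_rpow (by positivity) (by norm_num)]
    congr 1
    rw [hρd, hcd]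
    field_simp
  rw [e3, show (1 - ν) = -ν + 1 by ring, Real.rpow_add_one (by norm_num)]
  ring

theorem matern_zero (ν a : ℝ) : matern ν a 0 = 1 := by simp [matern]

/-! ### The spectral measure -/

section Spectral

variable (E : Type*) [NormedAddCommGroup E] [InnerProductSpace ℝ E] [FiniteDimensional ℝ E]
  [MeasurableSpace E] [BorelSpace E]

/-- The spectral measure of the Matérn covariance on a Euclidean space `E` (a multivariate
Student distribution): the law of `V ^ (-1/2) • N`, where `N` is a standard Gaussian vector and
`V` is an independent Gamma variable of shape `ν` and rate `a² / 2`. -/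
noncomputable def maternSpectral (ν a : ℝ) : Measure E :=
  ((gammaMeasure ν (a ^ 2 / 2)).prod (stdGaussian E)).map fun p => (√p.1)⁻¹ • p.2

theorem measurable_inv_sqrt_smul :
    Measurable fun p : ℝ × E => (√p.1)⁻¹ • p.2 := by
  fun_prop

variable {E} {ν a : ℝ}

theorem isProbabilityMeasure_maternSpectral (hν : 0 < ν) (ha : 0 < a) :
    IsProbabilityMeasure (maternSpectral E ν a) := by
  have := isProbabilityMeasure_gammaMeasure hν (show 0 < a ^ 2 / 2 by positivity)
  exact Measure.isProbabilityMeasure_map (measurable_inv_sqrt_smul E).aemeasurable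

theorem charFun_maternSpectral (hν : 0 < ν) (ha : 0 < a) (h : E) :
    charFun (maternSpectral E ν a) h = matern ν a ‖h‖ := by
  have := isProbabilityMeasure_gammaMeasure hν (show 0 < a ^ 2 / 2 by positivity)
  have hm : Measurable fun p : ℝ × E =>
      Complex.exp ((inner ℝ ((√p.1)⁻¹ • p.2) h : ℝ) * Complex.I) := by fun_prop
  rw [charFun_apply, maternSpectral, integral_map (measurable_inv_sqrt_smul E).aemeasurable
    (by fun_prop), integral_prod, matern_eq_integral hν ha (norm_nonneg h),
    ← integral_complex_ofReal]
  · refine integral_congr_ae ?_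
    filter_upwards [ae_pos_gammaMeasure ν (a ^ 2 / 2)] with v hv
    have h1 : ∀ n : E, (inner ℝ ((√v)⁻¹ • n) h : ℝ) = inner ℝ n ((√v)⁻¹ • h) := fun n => by
      rw [real_inner_smul_left, real_inner_smul_right]
    simp_rw [h1]
    rw [← charFun_apply, charFun_stdGaussian, norm_smul, Complex.ofReal_exp]
    congr 1
    have h2 : (‖(√v)⁻¹‖ * ‖h‖) ^ 2 = ‖h‖ ^ 2 / v := by
      rw [mul_pow, Real.norm_eq_abs, sq_abs, inv_pow, Real.sq_sqrt hv.le]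
      field_simp
    rw [← Complex.ofReal_pow, h2]
    push_cast
    ring
  · refine (integrable_const (1 : ℝ)).mono' hm.aestronglyMeasurable (ae_of_all _ fun p => ?_)
    rw [Complex.norm_exp_ofReal_mul_I]

/-- Spectral representation of the Matérn function. -/
theorem integral_cos_maternSpectral (hν : 0 < ν) (ha : 0 < a) (h : E) :
    ∫ ξ, Real.cos (inner ℝ ξ h) ∂maternSpectral E ν a = matern ν a ‖h‖ := by
  have := isProbabilityMeasure_maternSpectral (E := E) hν ha
  have h1 := charFun_maternSpectral hν ha h
  have hi : Integrable (fun ξ : E => Complex.exp ((inner ℝ ξ h : ℝ) * Complex.I))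
      (maternSpectral E ν a) := by
    refine (integrable_const (1 : ℝ)).mono' (by fun_prop) (ae_of_all _ fun p => ?_)
    rw [Complex.norm_exp_ofReal_mul_I]
  have h2 := congrArg Complex.re h1
  rw [charFun_apply, Complex.ofReal_re] at h2
  rw [← h2]
  have h3 := integral_re hi
  simp only [RCLike.re_eq_complex_re] at h3
  rw [← h3]
  simp [Complex.exp_ofReal_mul_I_re]

/-- The spectral measure has moments of all orders below `2ν`. -/
theorem integrable_norm_rpow_maternSpectral (hν : 0 < ν) (ha : 0 < a) {q : ℝ} (hq : 0 ≤ q)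
    (hqν : q < 2 * ν) : Integrable (fun ξ : E => ‖ξ‖ ^ q) (maternSpectral E ν a) := by
  have hρ : 0 < a ^ 2 / 2 := by positivity
  have := isProbabilityMeasure_gammaMeasure hν hρ
  have hN : Integrable (fun n : E => ‖n‖ ^ q) (stdGaussian E) := by
    rcases hq.eq_or_lt with rfl | hq
    · simp
    have h1 := IsGaussian.memLp_id (stdGaussian E) (ENNReal.ofReal q) ENNReal.ofReal_ne_top
    have h2 := h1.integrable_norm_rpow (by simpa using hq) ENNReal.ofReal_ne_top
    rw [ENNReal.toReal_ofReal hq.le] at h2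
    exact h2
  rw [maternSpectral, integrable_map_measure (by fun_prop)
    (measurable_inv_sqrt_smul E).aemeasurable]
  have h3 := (integrable_rpow_gammaMeasure (q := -(q / 2)) hν hρ (by linarith)).mul_prod hN
  refine h3.congr ?_
  have h4 : ∀ᵐ p ∂(gammaMeasure ν (a ^ 2 / 2)).prod (stdGaussian E), 0 < p.1 :=
    Measure.quasiMeasurePreserving_fst.ae (ae_pos_gammaMeasure ν (a ^ 2 / 2))
  filter_upwards [h4] with p hp
  simp only [Function.comp]
  rw [norm_smul, Real.mul_rpow (norm_nonneg _) (norm_nonneg _), norm_inv,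
    Real.norm_of_nonneg (Real.sqrt_nonneg _), Real.sqrt_eq_rpow, ← Real.rpow_neg hp.le,
    ← Real.rpow_mul hp.le]
  ring_nf

theorem memLp_two_maternSpectral (hν : 1 < ν) (ha : 0 < a) :
    MemLp id 2 (maternSpectral E ν a) := by
  rw [memLp_two_iff_integrable_sq_norm (by fun_prop)]
  have := integrable_norm_rpow_maternSpectral (E := E) (ν := ν) (by linarith) ha (q := 2)
    (by norm_num) (by linarith)
  simpa using this

/-- The second moment of the one-dimensional spectral measure. -/
theorem integral_sq_maternSpectral (hν : 1 < ν) (ha : 0 < a) :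
    ∫ x, x ^ 2 ∂maternSpectral ℝ ν a = a ^ 2 / (2 * (ν - 1)) := by
  have hρ : 0 < a ^ 2 / 2 := by positivity
  have := isProbabilityMeasure_gammaMeasure (show 0 < ν by linarith) hρ
  have hN : ∫ n : ℝ, n ^ 2 ∂stdGaussian ℝ = 1 := by
    have h1 := variance_dual_stdGaussian (E := ℝ) (ContinuousLinearMap.id ℝ ℝ)
    rw [variance_of_integral_eq_zero (by fun_prop) (integral_strongDual_stdGaussian _)] at h1
    simpa using h1
  rw [maternSpectral, integral_map (measurable_inv_sqrt_smul ℝ).aemeasurable (by fun_prop)]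
  have h4 : ∀ᵐ p ∂(gammaMeasure ν (a ^ 2 / 2)).prod (stdGaussian ℝ), 0 < p.1 :=
    Measure.quasiMeasurePreserving_fst.ae (ae_pos_gammaMeasure ν (a ^ 2 / 2))
  have h5 : ∫ p, ((√p.1)⁻¹ • p.2) ^ 2 ∂(gammaMeasure ν (a ^ 2 / 2)).prod (stdGaussian ℝ) =
      ∫ p, p.1⁻¹ * p.2 ^ 2 ∂(gammaMeasure ν (a ^ 2 / 2)).prod (stdGaussian ℝ) := by
    refine integral_congr_ae ?_
    filter_upwards [h4] with p hp
    rw [smul_eq_mul, mul_pow, inv_pow, Real.sq_sqrt hp.le]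
  rw [h5, integral_prod_mul (fun v : ℝ => v⁻¹) (fun n : ℝ => n ^ 2), hN,
    integral_inv_gammaMeasure hν hρ]
  have : ν - 1 ≠ 0 := by linarith
  field_simp

/-! ### Smoothness of the Matérn covariance for `ν > 1` -/

theorem contDiff_matern_norm (hν : 1 < ν) (ha : 0 < a) :
    ContDiff ℝ 2 fun h : E => matern ν a ‖h‖ := by
  have hν0 : 0 < ν := by linarith
  have := isProbabilityMeasure_maternSpectral (E := E) hν0 ha
  have h1 : ContDiff ℝ 2 (charFun (maternSpectral E ν a)) := by
    have := contDiff_charFun (n := 2) (by simpa using memLp_two_maternSpectral (E := E) hν ha)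
    exact_mod_cast this
  have h2 := Complex.reCLM.contDiff.comp h1
  convert h2 using 1
  ext h
  simp [charFun_maternSpectral hν0 ha]

theorem deriv_deriv_matern_abs (hν : 1 < ν) (ha : 0 < a) :
    deriv (deriv fun t : ℝ => matern ν a |t|) 0 = -a ^ 2 / (2 * (ν - 1)) := by
  have hν0 : 0 < ν := by linarith
  have := isProbabilityMeasure_maternSpectral (E := ℝ) hν0 ha
  set φ := charFun (maternSpectral ℝ ν a) with hφ
  have hL : MemLp id ((2 : ℕ) : ENNReal) (maternSpectral ℝ ν a) := by
    simpa using memLp_two_maternSpectral (E := ℝ) hν ha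
  have h1 : ContDiff ℝ 2 φ := by
    have := contDiff_charFun (n := 2) hL
    exact_mod_cast this
  have hm : (fun t : ℝ => matern ν a |t|) = fun t => (φ t).re := by
    ext t
    rw [hφ, charFun_maternSpectral hν0 ha, Complex.ofReal_re, Real.norm_eq_abs]
  have hre : ∀ {F : ℝ → ℂ}, Differentiable ℝ F →
      deriv (fun t => (F t).re) = fun t => (deriv F t).re := by
    intro F hF
    ext t
    exact (Complex.reCLM.hasFDerivAt.comp_hasDerivAt t (hF t).hasDerivAt).deriv
  have hd1 : Differentiable ℝ φ := h1.differentiable (by norm_num)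
  have hd2 : Differentiable ℝ (deriv φ) := by
    have : ContDiff ℝ 1 (deriv φ) := (contDiff_succ_iff_deriv (n := 1).1 (by exact_mod_cast h1)).2.2
    exact this.differentiable (by norm_num)
  have h3 : deriv (deriv φ) 0 = iteratedDeriv 2 φ 0 := by
    rw [iteratedDeriv_succ, iteratedDeriv_one]
  rw [hm, hre hd1, hre hd2]
  beta_reduce
  rw [h3, hφ, iteratedDeriv_charFun_zero hL, Complex.I_sq, integral_sq_maternSpectral hν ha]
  rw [neg_one_mul, Complex.neg_re, Complex.ofReal_re]
  ring

end Spectral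

theorem contDiff_matern_abs {ν a : ℝ} (hν : 1 < ν) (ha : 0 < a) :
    ContDiff ℝ 2 fun t : ℝ => matern ν a |t| :=
  contDiff_matern_norm (E := ℝ) hν ha

theorem eqOn_matern_abs (ν a : ℝ) :
    Set.EqOn (matern ν a) (fun t : ℝ => matern ν a |t|) (Set.Ici 0) := fun t ht => by
  simp [abs_of_nonneg (Set.mem_Ici.1 ht)]

theorem contDiffOn_matern {ν a : ℝ} (hν : 1 < ν) (ha : 0 < a) :
    ContDiffOn ℝ 2 (matern ν a) (Set.Ici 0) :=
  (contDiff_matern_abs hν ha).contDiffOn.congr (eqOn_matern_abs ν a)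

theorem radialF_matern_zero {ν a : ℝ} (hν : 1 < ν) (ha : 0 < a) :
    radialF (matern ν a) 0 = deriv (deriv fun t : ℝ => matern ν a |t|) 0 := by
  have hC := contDiff_matern_abs hν ha
  have hd1 : Differentiable ℝ fun t : ℝ => matern ν a |t| := hC.differentiable (by norm_num)
  have hd2 : Differentiable ℝ (deriv fun t : ℝ => matern ν a |t|) := by
    have := (contDiff_succ_iff_deriv (n := 1).1 (by exact_mod_cast hC)).2.2
    exact this.differentiable (by norm_num)
  have h1 : Set.EqOn (derivWithin (matern ν a) (Set.Ici 0))
      (deriv fun t : ℝ => matern ν a |t|) (Set.Ici 0) := by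
    intro t ht
    rw [derivWithin_congr (eqOn_matern_abs ν a) (eqOn_matern_abs ν a ht)]
    exact (hd1 t).derivWithin (uniqueDiffOn_Ici 0 t ht)
  have h0 : (0 : ℝ) ∈ Set.Ici (0 : ℝ) := Set.self_mem_Ici
  rw [radialF, if_pos rfl, derivWithin_congr h1 (h1 h0)]
  exact (hd2 0).derivWithin (uniqueDiffOn_Ici 0 0 h0)

theorem norm_e (i : Fin 3) : ‖e i‖ = 1 := by simp [e]

/-- The Hessian at the origin of a radial function `h ↦ f ‖h‖`, for an even profile `f`. The mixed
derivatives vanish because `u ↦ f ‖t eᵢ + u eⱼ‖` is even. -/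
theorem hessian_radial (f : ℝ → ℝ) (hf : ∀ t, f |t| = f t) :
    hessian (fun h : E3 => f ‖h‖) 0 = deriv (deriv f) 0 • (1 : Matrix (Fin 3) (Fin 3) ℝ) := by
  ext i j
  simp only [hessian, Matrix.of_apply, Matrix.smul_apply, Matrix.one_apply, smul_eq_mul, mul_ite,
    mul_one, mul_zero, lineDeriv, zero_add]
  split_ifs with hij
  · subst hij
    have h1 : (fun t : ℝ => deriv (fun u : ℝ => f ‖t • e i + u • e i‖) 0) = deriv f := by
      ext t
      have : (fun u : ℝ => f ‖t • e i + u • e i‖) = fun u => f (t + u) := by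
        ext u
        rw [← add_smul, norm_smul, norm_e, mul_one, Real.norm_eq_abs, hf]
      rw [this, deriv_comp_const_add, add_zero]
    rw [h1]
  · have h1 : ∀ t : ℝ, deriv (fun u : ℝ => f ‖t • e i + u • e j‖) 0 = 0 := by
      intro t
      have heven : ∀ u : ℝ, f ‖t • e i + (-u) • e j‖ = f ‖t • e i + u • e j‖ := by
        intro u
        have ho : inner ℝ (e i) (e j) = (0 : ℝ) := by
          rw [e, e, EuclideanSpace.inner_single_left]
          simp [hij]
        congr 1
        rw [← sq_eq_sq₀ (norm_nonneg _) (norm_nonneg _), norm_add_sq_real, norm_add_sq_real]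
        simp [real_inner_smul_left, real_inner_smul_right, ho, norm_smul]
      have h2 := deriv_comp_neg (fun u : ℝ => f ‖t • e i + u • e j‖) 0
      simp only [heven, neg_zero] at h2
      linarith
    simp [h1]

theorem hessian_matern {ν a : ℝ} (hν : 1 < ν) (ha : 0 < a) :
    hessian (fun h : E3 => matern ν a ‖h‖) 0
      = radialF (matern ν a) 0 • (1 : Matrix (Fin 3) (Fin 3) ℝ) := by
  rw [radialF_matern_zero hν ha, ← hessian_radial (fun t => matern ν a |t|) (by simp)]
  simp

/-! ### Necessity of `ν > 1` -/

/-- An even function that is twice continuously differentiable at `0` is flat to second order. -/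
theorem exists_eventually_abs_sub_le_of_even {c : ℝ → ℝ} (hc : ContDiffAt ℝ 2 c 0)
    (heven : ∀ᶠ t in 𝓝 (0 : ℝ), c (-t) = c t) :
    ∃ K : ℝ, ∀ᶠ t in 𝓝 (0 : ℝ), |c t - c 0| ≤ K * t ^ 2 := by
  have hd0 : deriv c 0 = 0 := by
    have h1 : deriv (fun t => c (-t)) 0 = deriv c 0 :=
      EventuallyEq.deriv_eq heven
    rw [deriv_comp_neg, neg_zero] at h1
    linarith
  have hdiff : ∀ᶠ t in 𝓝 (0 : ℝ), DifferentiableAt ℝ c t :=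
    (hc.eventually (by simp)).mono fun t ht => ht.differentiableAt (by norm_num)
  have hd : DifferentiableAt ℝ (deriv c) 0 :=
    (hc.derivWithin (m := 1) (by norm_num)).differentiableAt (by norm_num)
  have hO : (deriv c) =O[𝓝 0] fun t : ℝ => t := by
    simpa [hd0] using hd.isBigO_sub
  obtain ⟨K, hK⟩ := hO.bound
  obtain ⟨δ, hδ, hball⟩ := Metric.eventually_nhds_iff_ball.1 (hdiff.and hK)
  refine ⟨K, Metric.eventually_nhds_iff_ball.2 ⟨δ, hδ, fun t ht => ?_⟩⟩
  have htδ : |t| < δ := by simpa using ht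
  have hmem : ∀ x ∈ Metric.closedBall (0 : ℝ) |t|, x ∈ Metric.ball (0 : ℝ) δ := fun x hx =>
    Metric.closedBall_subset_ball htδ hx
  have hKt : 0 ≤ K * |t| := by
    have := (hball t ht).2
    exact (norm_nonneg _).trans this
  have hb : ∀ x ∈ Metric.closedBall (0 : ℝ) |t|, ‖deriv c x‖ ≤ K * |t| := by
    intro x hx
    have h1 := (hball x (hmem x hx)).2
    have hxt : |x| ≤ |t| := by simpa using hx
    rcases le_or_gt 0 K with hK0 | hK0
    · refine h1.trans ?_
      rw [Real.norm_eq_abs]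
      gcongr
    · have : K * ‖x‖ ≤ 0 := mul_nonpos_of_nonpos_of_nonneg hK0.le (norm_nonneg _)
      linarith
  have := (convex_closedBall (0 : ℝ) |t|).norm_image_sub_le_of_norm_deriv_le
    (fun x hx => (hball x (hmem x hx)).1) hb (x := 0) (y := t) (by simp) (by simp)
  rw [Real.norm_eq_abs, sub_zero, Real.norm_eq_abs, mul_assoc, ← sq, sq_abs] at this
  exact this

theorem tendsto_one_sub_exp_div (x : ℝ) :
    Tendsto (fun s : ℝ => (1 - Real.exp (-(x * s))) / s) (𝓝[>] 0) (𝓝 x) := by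
  have h : HasDerivAt (fun s : ℝ => 1 - Real.exp (-(x * s))) x 0 := by
    have := (((hasDerivAt_id (0 : ℝ)).const_mul x).neg.exp).const_sub 1
    simpa using this
  have := (hasDerivAt_iff_tendsto_slope_zero.1 h).mono_left
    (nhdsWithin_mono 0 fun s (hs : s ∈ Set.Ioi 0) => (Set.mem_Ioi.1 hs).ne')
  simpa [div_eq_inv_mul] using this

/-- If `1 - M(r)` is of order `r²` then, by Fatou's lemma, `1 / V` has finite mean. -/
theorem one_lt_of_one_sub_matern_le {ν a K : ℝ} (hν : 0 < ν) (ha : 0 < a)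
    (hK : ∀ᶠ t in 𝓝[>] (0 : ℝ), 1 - matern ν a t ≤ K * t ^ 2) : 1 < ν := by
  have hρ : 0 < a ^ 2 / 2 := by positivity
  have := isProbabilityMeasure_gammaMeasure hν hρ
  set γ := gammaMeasure ν (a ^ 2 / 2) with hγ
  set s : ℕ → ℝ := fun n => 1 / ((n : ℝ) + 1) with hs
  have hs0 : ∀ n, 0 < s n := fun n => by positivity
  have hslim : Tendsto s atTop (𝓝[>] 0) :=
    tendsto_nhdsWithin_iff.2 ⟨tendsto_one_div_add_atTop_nhds_zero_nat, .of_forall hs0⟩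
  have htlim : Tendsto (fun n => √(s n)) atTop (𝓝[>] 0) := by
    refine tendsto_nhdsWithin_iff.2 ⟨?_, .of_forall fun n => Real.sqrt_pos.2 (hs0 n)⟩
    have := (Real.continuous_sqrt.tendsto 0).comp (hslim.mono_right nhdsWithin_le_nhds)
    simpa [Function.comp_def] using this
  set F : ℕ → ℝ → ENNReal := fun n v =>
    ENNReal.ofReal ((1 - Real.exp (-((2 * v)⁻¹ * s n))) / s n) with hF
  have hFm : ∀ n, Measurable (F n) := fun n => by fun_prop
  have hint : ∀ᶠ n in atTop, ∫⁻ v, F n v ∂γ ≤ ENNReal.ofReal K := by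
    filter_upwards [htlim.eventually hK] with n hn
    have hexp : Integrable (fun v : ℝ => Real.exp (-((2 * v)⁻¹ * s n))) γ := by
      refine (integrable_const (1 : ℝ)).mono' (by fun_prop) ?_
      filter_upwards [ae_pos_gammaMeasure ν (a ^ 2 / 2)] with v hv
      rw [Real.norm_of_nonneg (Real.exp_nonneg _), Real.exp_le_one_iff]
      have := hs0 n
      have : 0 ≤ (2 * v)⁻¹ * s n := by positivity
      linarith
    rw [hF]
    beta_reduce
    rw [← ofReal_integral_eq_lintegral_ofReal]
    · refine ENNReal.ofReal_le_ofReal ?_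
      rw [integral_div, integral_sub (integrable_const _) hexp]
      rw [matern_eq_integral hν ha (Real.sqrt_nonneg _), Real.sq_sqrt (hs0 n).le] at hn
      rw [div_le_iff₀ (hs0 n)]
      have he : ∀ v : ℝ, (2 * v)⁻¹ * s n = s n / (2 * v) := fun v => by ring
      simp_rw [he]
      simpa using hn
    · exact ((integrable_const _).sub hexp).div_const _
    · filter_upwards [ae_pos_gammaMeasure ν (a ^ 2 / 2)] with v hv
      have := hs0 n
      refine div_nonneg (sub_nonneg.2 (Real.exp_le_one_iff.2 ?_)) this.le
      have : 0 ≤ (2 * v)⁻¹ * s n := by positivity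
      linarith
  have hlim : ∀ v, liminf (fun n => F n v) atTop = ENNReal.ofReal ((2 * v)⁻¹) := fun v =>
    ((ENNReal.continuous_ofReal.tendsto _).comp
      ((tendsto_one_sub_exp_div (2 * v)⁻¹).comp hslim)).liminf_eq
  have hfat : ∫⁻ v, ENNReal.ofReal ((2 * v)⁻¹) ∂γ ≤ ENNReal.ofReal K := by
    simp_rw [← hlim]
    refine (lintegral_liminf_le hFm).trans ?_
    exact liminf_le_of_frequently_le' hint.frequently
  refine one_lt_of_integrable_inv_gammaMeasure hν hρ ?_
  have h2 : Integrable (fun v : ℝ => (2 * v)⁻¹) γ := by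
    refine ⟨by fun_prop, ?_⟩
    rw [hasFiniteIntegral_iff_ofReal]
    · exact hfat.trans_lt ENNReal.ofReal_lt_top
    · filter_upwards [ae_pos_gammaMeasure ν (a ^ 2 / 2)] with v hv
      simp only [Pi.zero_apply]
      positivity
  refine (h2.const_mul 2).congr (ae_of_all _ fun v => ?_)
  ring

theorem isOpen_shell (ε : ℝ) : IsOpen (shell ε) :=
  (isOpen_lt continuous_const continuous_norm).inter (isOpen_lt continuous_norm continuous_const)

theorem e_mem_shell {ε : ℝ} (hε : 0 < ε) (i : Fin 3) : e i ∈ shell ε := by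
  simp [shell, norm_e, hε]

theorem lags_mem_nhds_zero {S : Set E3} (hS : IsOpen S) {p : E3} (hp : p ∈ S) :
    lags S ∈ 𝓝 (0 : E3) := by
  have h : Tendsto (fun h : E3 => p + h) (𝓝 0) (𝓝 p) := by
    have : Continuous fun h : E3 => p + h := by fun_prop
    simpa using this.tendsto 0
  filter_upwards [h (hS.mem_nhds hp)] with x hx
  exact ⟨p + x, hx, p, hp, by abel⟩

theorem one_lt_of_conditionA2 {Ω : Type*} [MeasurableSpace Ω] {P : Measure Ω} {ε ν a : ℝ}
    (hε : 0 < ε) (hν : 0 < ν) (ha : 0 < a) {Z : E3 → Ω → ℝ}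
    (hcov : ∀ s ∈ shell ε, ∀ t ∈ shell ε, cov[Z s, Z t; P] = matern ν a ‖s - t‖)
    (h : ConditionA2 P (shell ε) Z) : 1 < ν := by
  obtain ⟨C, hC, hCd⟩ := h
  have hCm : ∀ h ∈ lags (shell ε), C h = matern ν a ‖h‖ := by
    rintro _ ⟨s, hs, t, ht, rfl⟩
    rw [← hC.cov_eq s hs t ht, hcov s hs t ht]
  have hl := lags_mem_nhds_zero (isOpen_shell ε) (e_mem_shell hε 0)
  have hline : Tendsto (fun t : ℝ => t • e 0) (𝓝 0) (𝓝 0) := by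
    have : Continuous fun t : ℝ => t • e 0 := by fun_prop
    simpa using this.tendsto 0
  have hc : ∀ᶠ t in 𝓝 (0 : ℝ), C (t • e 0) = matern ν a |t| := by
    filter_upwards [hline hl] with t ht
    rw [hCm _ ht, norm_smul, norm_e, mul_one, Real.norm_eq_abs]
  have hcd : ContDiffAt ℝ 2 (fun t : ℝ => C (t • e 0)) 0 := by
    have h1 : ContDiffAt ℝ 2 C ((fun t : ℝ => t • e 0) 0) := by
      simpa using hCd.contDiffAt hl
    exact h1.comp 0 (by fun_prop)
  obtain ⟨K, hK⟩ := exists_eventually_abs_sub_le_of_even hcd (by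
    have hneg : Tendsto (fun t : ℝ => -t) (𝓝 0) (𝓝 0) := by simpa using tendsto_neg (0 : ℝ)
    filter_upwards [hc, hneg.eventually hc] with t h1 h2
    rw [h1, h2, abs_neg])
  refine one_lt_of_one_sub_matern_le hν ha (K := K) ?_
  filter_upwards [nhdsWithin_le_nhds hK, nhdsWithin_le_nhds hc, self_mem_nhdsWithin]
    with t h1 h2 (h3 : 0 < t)
  have h0 := hc.self_of_nhds
  rw [h2, h0, abs_zero, matern_zero, abs_of_pos h3] at h1
  linarith [(abs_le.1 h1).1]

/-! ### Dyadic chaining -/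

section Dyadic

variable {ι : Type*}

/-- The dyadic point `k / 2ⁿ`. -/
noncomputable def dyadicPt (n : ℕ) (k : ι → ℤ) : ι → ℝ := fun j => (k j : ℝ) / 2 ^ n

/-- Coordinatewise rounding up to the dyadic grid of level `n`. -/
noncomputable def dyadicCeil (n : ℕ) (x : ι → ℝ) : ι → ℤ := fun j => ⌈2 ^ n * x j⌉

theorem dyadicPt_add (n d : ℕ) (k : ι → ℤ) :
    dyadicPt (n + d) (fun j => 2 ^ d * k j) = dyadicPt n k := by
  ext j
  simp only [dyadicPt, pow_add]
  push_cast
  field_simp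

theorem dyadicCeil_dyadicPt (n : ℕ) (k : ι → ℤ) : dyadicCeil n (dyadicPt n k) = k := by
  ext j
  simp only [dyadicCeil, dyadicPt]
  rw [mul_div_cancel₀ _ (by positivity), Int.ceil_intCast]

variable [Fintype ι] [DecidableEq ι]

variable (ι) in
/-- Indices of the dyadic points of level `n` in the half-open unit cube `(0, 1]^ι`. -/
noncomputable def dyadicIndex (n : ℕ) : Finset (ι → ℤ) :=
  Fintype.piFinset fun _ => Finset.Icc 1 (2 ^ n)

variable (ι) in
/-- The dyadic points of the half-open unit cube `(0, 1]^ι`. -/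
def dyadicCube : Set (ι → ℝ) := {x | ∃ n, ∃ k ∈ dyadicIndex ι n, x = dyadicPt n k}

variable (ι) in
/-- Index offsets of neighbouring points of a dyadic grid. -/
noncomputable def dyadicOffset : Finset (ι → ℤ) := Fintype.piFinset fun _ => Finset.Icc (-1) 1

theorem mem_dyadicIndex {n : ℕ} {k : ι → ℤ} :
    k ∈ dyadicIndex ι n ↔ ∀ j, 1 ≤ k j ∧ k j ≤ 2 ^ n := by
  simp [dyadicIndex]

theorem mem_dyadicOffset {k : ι → ℤ} : k ∈ dyadicOffset ι ↔ ∀ j, -1 ≤ k j ∧ k j ≤ 1 := by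
  simp [dyadicOffset]

theorem dyadicCeil_mem {n : ℕ} {x : ι → ℝ} (hx : ∀ j, 0 < x j ∧ x j ≤ 1) :
    dyadicCeil n x ∈ dyadicIndex ι n := by
  refine mem_dyadicIndex.2 fun j => ⟨?_, ?_⟩
  · have : 0 < ⌈(2 : ℝ) ^ n * x j⌉ := Int.ceil_pos.2 (mul_pos (by positivity) (hx j).1)
    exact this
  · refine Int.ceil_le.2 ?_
    push_cast
    exact mul_le_of_le_one_right (by positivity) (hx j).2

theorem dyadicPt_mem_unit {n : ℕ} {k : ι → ℤ} (hk : k ∈ dyadicIndex ι n) (j : ι) :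
    0 < dyadicPt n k j ∧ dyadicPt n k j ≤ 1 := by
  have h := mem_dyadicIndex.1 hk j
  have h1 : (1 : ℝ) ≤ k j := by exact_mod_cast h.1
  have h2 : (k j : ℝ) ≤ 2 ^ n := by exact_mod_cast h.2
  refine ⟨div_pos (by linarith) (by positivity), ?_⟩
  exact (div_le_one (by positivity)).2 h2

theorem mem_unit_of_mem_dyadicCube {x : ι → ℝ} (hx : x ∈ dyadicCube ι) (j : ι) :
    0 < x j ∧ x j ≤ 1 := by
  obtain ⟨n, k, hk, rfl⟩ := hx
  exact dyadicPt_mem_unit hk j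

theorem exists_level_of_mem_dyadicCube {x : ι → ℝ} (hx : x ∈ dyadicCube ι) :
    ∃ N, ∀ d, ∃ k ∈ dyadicIndex ι (N + d), x = dyadicPt (N + d) k := by
  obtain ⟨n, k, hk, rfl⟩ := hx
  refine ⟨n, fun d => ⟨fun j => 2 ^ d * k j, mem_dyadicIndex.2 fun j => ?_,
    (dyadicPt_add n d k).symm⟩⟩
  have h := mem_dyadicIndex.1 hk j
  have h2 : (1 : ℤ) ≤ 2 ^ d := one_le_pow₀ (by norm_num)
  refine ⟨by nlinarith, ?_⟩
  rw [pow_add, mul_comm ((2 : ℤ) ^ n)]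
  exact mul_le_mul_of_nonneg_left h.2 (by positivity)

/-- Rounding up to level `n` is one grid step of level `n + 1` away from rounding to level
`n + 1`. -/
theorem dyadicCeil_succ_offset (n : ℕ) (x : ι → ℝ) :
    (fun j => 2 * dyadicCeil n x j) - dyadicCeil (n + 1) x ∈ dyadicOffset ι := by
  refine mem_dyadicOffset.2 fun j => ?_
  simp only [Pi.sub_apply, dyadicCeil]
  have h1 := Int.le_ceil ((2 : ℝ) ^ n * x j)
  have h2 := Int.ceil_lt_add_one ((2 : ℝ) ^ n * x j)
  have h3 := Int.le_ceil ((2 : ℝ) ^ (n + 1) * x j)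
  have h4 := Int.ceil_lt_add_one ((2 : ℝ) ^ (n + 1) * x j)
  have h5 : (2 : ℝ) ^ (n + 1) * x j = 2 * (2 ^ n * x j) := by ring
  rw [h5] at h3 h4 ⊢
  set y := (2 : ℝ) ^ n * x j
  constructor
  · have : ((⌈2 * y⌉ : ℤ) : ℝ) < ((2 * ⌈y⌉ + 1 : ℤ) : ℝ) := by push_cast; linarith
    have := Int.cast_lt.1 this
    omega
  · have : ((2 * ⌈y⌉ : ℤ) : ℝ) < ((⌈2 * y⌉ + 2 : ℤ) : ℝ) := by push_cast; linarith
    have := Int.cast_lt.1 this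
    omega

theorem dyadicCeil_offset_of_dist_lt {n : ℕ} {x y : ι → ℝ} (h : dist x y < (1 / 2) ^ n) :
    dyadicCeil n x - dyadicCeil n y ∈ dyadicOffset ι := by
  refine mem_dyadicOffset.2 fun j => ?_
  have h0 : |x j - y j| < (1 / 2) ^ n := (dist_le_pi_dist x y j).trans_lt h
  have hp : (0 : ℝ) < 2 ^ n := by positivity
  have h1 : |2 ^ n * x j - 2 ^ n * y j| < 1 := by
    rw [← mul_sub, abs_mul, abs_of_pos hp]
    calc 2 ^ n * |x j - y j| < 2 ^ n * (1 / 2) ^ n := by gcongr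
      _ = 1 := by rw [← mul_pow]; norm_num
  have h2 := abs_lt.1 h1
  simp only [Pi.sub_apply, dyadicCeil]
  have a1 := Int.le_ceil ((2 : ℝ) ^ n * x j)
  have a2 := Int.ceil_lt_add_one ((2 : ℝ) ^ n * x j)
  have a3 := Int.le_ceil ((2 : ℝ) ^ n * y j)
  have a4 := Int.ceil_lt_add_one ((2 : ℝ) ^ n * y j)
  constructor
  · have : ((⌈2 ^ n * y j⌉ : ℤ) : ℝ) < ((⌈2 ^ n * x j⌉ + 2 : ℤ) : ℝ) := by push_cast; linarith
    have := Int.cast_lt.1 this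
    omega
  · have : ((⌈2 ^ n * x j⌉ : ℤ) : ℝ) < ((⌈2 ^ n * y j⌉ + 2 : ℤ) : ℝ) := by push_cast; linarith
    have := Int.cast_lt.1 this
    omega

theorem dist_dyadicPt_le {n : ℕ} {k l : ι → ℤ} (h : l - k ∈ dyadicOffset ι) :
    dist (dyadicPt n l) (dyadicPt n k) ≤ (1 / 2) ^ n := by
  refine (dist_pi_le_iff (by positivity)).2 fun j => ?_
  have h1 := mem_dyadicOffset.1 h j
  simp only [Pi.sub_apply] at h1
  have h2 : |(l j : ℝ) - k j| ≤ 1 := by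
    rw [abs_le]
    exact ⟨by exact_mod_cast h1.1, by exact_mod_cast h1.2⟩
  have hp : (0 : ℝ) < 2 ^ n := by positivity
  rw [Real.dist_eq, dyadicPt, dyadicPt, ← sub_div, abs_div, abs_of_pos hp, one_div, inv_pow,
    div_eq_mul_inv]
  exact mul_le_of_le_one_left (by positivity) h2

/-- Chaining: a function whose increments between neighbouring points of the dyadic grid of level
`n` are of order `θⁿ`, with `θ < 1`, is uniformly continuous on the dyadic points. -/
theorem uniformContinuousOn_dyadicCube {f : (ι → ℝ) → ℝ} {C θ : ℝ} (hC : 0 ≤ C) (hθ : 0 < θ)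
    (hθ1 : θ < 1)
    (hf : ∀ n, ∀ k ∈ dyadicIndex ι n, ∀ l ∈ dyadicIndex ι n, l - k ∈ dyadicOffset ι →
      |f (dyadicPt n l) - f (dyadicPt n k)| ≤ C * θ ^ n) :
    UniformContinuousOn f (dyadicCube ι) := by
  have h1θ : 0 < 1 - θ := by linarith
  have hstep : ∀ (x : ι → ℝ), (∀ j, 0 < x j ∧ x j ≤ 1) → ∀ n,
      |f (dyadicPt n (dyadicCeil n x)) - f (dyadicPt (n + 1) (dyadicCeil (n + 1) x))|
        ≤ C * θ ^ n := by
    intro x hx n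
    have h1 := dyadicPt_add n 1 (dyadicCeil n x)
    rw [← h1]
    refine (hf (n + 1) _ (dyadicCeil_mem hx) _ ?_ ?_).trans ?_
    · rw [mem_dyadicIndex]
      intro j
      have := mem_dyadicIndex.1 (dyadicCeil_mem (n := n) hx) j
      rw [pow_one, pow_succ]
      constructor <;> omega
    · simpa using dyadicCeil_succ_offset n x
    · rw [pow_succ, ← mul_assoc]
      exact mul_le_of_le_one_right (by positivity) hθ1.le
  have hchain : ∀ (d n : ℕ) (k : ι → ℤ), k ∈ dyadicIndex ι (n + d) →
      |f (dyadicPt n (dyadicCeil n (dyadicPt (n + d) k))) - f (dyadicPt (n + d) k)|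
        ≤ C * θ ^ n / (1 - θ) := by
    intro d
    induction d with
    | zero =>
      intro n k hk
      rw [add_zero, dyadicCeil_dyadicPt, sub_self, abs_zero]
      positivity
    | succ d ih =>
      intro n k hk
      have e : n + (d + 1) = (n + 1) + d := by ring
      rw [e] at hk ⊢
      have h1 := ih (n + 1) k hk
      have h2 := hstep (dyadicPt (n + 1 + d) k) (dyadicPt_mem_unit hk) n
      have h3 : C * θ ^ n / (1 - θ) = C * θ ^ n + C * θ ^ (n + 1) / (1 - θ) := by
        field_simp
        ring
      rw [h3]
      exact (abs_sub_le _ _ _).trans (add_le_add h2 h1)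
  rw [Metric.uniformContinuousOn_iff]
  intro δ hδ
  obtain ⟨n, hn⟩ : ∃ n, (2 * C / (1 - θ) + C) * θ ^ n < δ := by
    have h := (tendsto_pow_atTop_nhds_zero_of_lt_one hθ.le hθ1).const_mul (2 * C / (1 - θ) + C)
    rw [mul_zero] at h
    exact (h.eventually (gt_mem_nhds hδ)).exists
  refine ⟨(1 / 2) ^ n, by positivity, fun x hx y hy hxy => ?_⟩
  have happrox : ∀ x ∈ dyadicCube ι,
      |f (dyadicPt n (dyadicCeil n x)) - f x| ≤ C * θ ^ n / (1 - θ) := by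
    intro x hx
    obtain ⟨N, hN⟩ := exists_level_of_mem_dyadicCube hx
    obtain ⟨k, hk, rfl⟩ := hN n
    rw [add_comm] at hk ⊢
    exact hchain N n k hk
  have h1 := happrox x hx
  have h2 := happrox y hy
  have h3 := hf n _ (dyadicCeil_mem (mem_unit_of_mem_dyadicCube hy)) _
    (dyadicCeil_mem (mem_unit_of_mem_dyadicCube hx)) (dyadicCeil_offset_of_dist_lt hxy)
  rw [Real.dist_eq]
  have h4 : (2 * C / (1 - θ) + C) * θ ^ n
      = C * θ ^ n / (1 - θ) + C * θ ^ n + C * θ ^ n / (1 - θ) := by ring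
  rw [h4] at hn
  refine lt_of_le_of_lt ?_ hn
  rw [abs_sub_comm] at h1
  exact (abs_sub_le _ _ _).trans (add_le_add ((abs_sub_le _ _ _).trans (add_le_add h1 h3)) h2)

/-! ### The Kolmogorov continuity criterion on dyadic points -/

theorem card_dyadicIndex (n : ℕ) : (dyadicIndex ι n).card = (2 ^ n) ^ Fintype.card ι := by
  have h : ((2 : ℤ) ^ n).toNat = 2 ^ n := by exact_mod_cast Int.toNat_natCast (2 ^ n)
  simp [dyadicIndex, h]

variable {Ω : Type*} [MeasurableSpace Ω] {P : Measure Ω}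

/-- Kolmogorov's continuity criterion: if the `p`-th moments of the increments between neighbours
on the dyadic grid of level `n` are of order `ηⁿ` with `η < 2 ^ (-d)`, then almost all paths are
uniformly continuous on the dyadic points of the `d`-dimensional unit cube. -/
theorem ae_uniformContinuousOn_dyadicCube {X : (ι → ℝ) → Ω → ℝ} {p : ℕ} (hp : p ≠ 0) {η : ℝ}
    {M : ENNReal} (hη : 0 ≤ η) (hη1 : 2 ^ Fintype.card ι * η < 1) (hM : M ≠ ⊤)
    (hXm : ∀ x ∈ dyadicCube ι, AEMeasurable (X x) P)
    (hX : ∀ n, ∀ k ∈ dyadicIndex ι n, ∀ l ∈ dyadicIndex ι n, l - k ∈ dyadicOffset ι →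
      ∫⁻ ω, ‖X (dyadicPt n l) ω - X (dyadicPt n k) ω‖ₑ ^ p ∂P ≤ M * ENNReal.ofReal (η ^ n)) :
    ∀ᵐ ω ∂P, UniformContinuousOn (fun x => X x ω) (dyadicCube ι) := by
  obtain ⟨θ, hθ, hθ1, hθη⟩ : ∃ θ : ℝ, 0 < θ ∧ θ < 1 ∧ 2 ^ Fintype.card ι * η < θ ^ p := by
    have h : Tendsto (fun θ : ℝ => θ ^ p) (𝓝[<] 1) (𝓝 1) := by
      have := (continuous_pow (M := ℝ) p).tendsto 1
      rw [one_pow] at this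
      exact this.mono_left nhdsWithin_le_nhds
    have h1 := h.eventually (lt_mem_nhds hη1)
    have h2 : ∀ᶠ θ : ℝ in 𝓝[<] 1, 0 < θ := nhdsWithin_le_nhds (lt_mem_nhds one_pos)
    obtain ⟨θ, h1, h2, h3⟩ := (h1.and (h2.and self_mem_nhdsWithin)).exists
    exact ⟨θ, h2, h3, h1⟩
  set c : ENNReal := ENNReal.ofReal (2 ^ Fintype.card ι * η / θ ^ p) with hc
  have hc1 : c < 1 := by
    rw [hc, ENNReal.ofReal_lt_one, div_lt_one (by positivity)]
    exact hθη
  -- the normalized sum of all increments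
  set T : ℕ → (ι → ℤ) → (ι → ℤ) → Ω → ENNReal := fun n k l ω =>
    if l - k ∈ dyadicOffset ι then
      ENNReal.ofReal ((θ ^ p)⁻¹ ^ n) * ‖X (dyadicPt n l) ω - X (dyadicPt n k) ω‖ₑ ^ p else 0
    with hT
  have hmem : ∀ {n k}, k ∈ dyadicIndex ι n → dyadicPt n k ∈ dyadicCube ι := fun {n k} hk =>
    ⟨n, k, hk, rfl⟩
  have hTm : ∀ n, ∀ k ∈ dyadicIndex ι n, ∀ l ∈ dyadicIndex ι n, AEMeasurable (T n k l) P := by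
    intro n k hk l hl
    by_cases hkl : l - k ∈ dyadicOffset ι
    · simp only [hT, if_pos hkl]
      exact ((((hXm _ (hmem hl)).sub (hXm _ (hmem hk))).enorm).pow_const p).const_mul _
    · simp only [hT, if_neg hkl]
      exact aemeasurable_const
  set S : ℕ → Ω → ENNReal := fun n ω =>
    ∑ k ∈ dyadicIndex ι n, ∑ l ∈ dyadicIndex ι n, T n k l ω with hS
  have hSm : ∀ n, AEMeasurable (S n) P := fun n =>
    Finset.aemeasurable_fun_sum _ fun k hk =>
      Finset.aemeasurable_fun_sum _ fun l hl => hTm n k hk l hl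
  have hSint : ∀ n, ∫⁻ ω, S n ω ∂P ≤ (dyadicOffset ι).card * M * c ^ n := by
    intro n
    have hTint : ∀ k ∈ dyadicIndex ι n, ∀ l ∈ dyadicIndex ι n, ∫⁻ ω, T n k l ω ∂P ≤
        if l - k ∈ dyadicOffset ι then
          ENNReal.ofReal ((θ ^ p)⁻¹ ^ n) * (M * ENNReal.ofReal (η ^ n)) else 0 := by
      intro k hk l hl
      by_cases hkl : l - k ∈ dyadicOffset ι
      · simp only [hT, if_pos hkl]
        rw [lintegral_const_mul' _ _ ENNReal.ofReal_ne_top]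
        gcongr
        exact hX n k hk l hl hkl
      · simp [hT, if_neg hkl]
    have hcount : ∀ k, ((dyadicIndex ι n).filter fun l => l - k ∈ dyadicOffset ι).card
        ≤ (dyadicOffset ι).card := by
      intro k
      refine Finset.card_le_card_of_injOn (fun l => l - k) ?_ ?_
      · intro l hl
        exact (Finset.mem_filter.1 hl).2
      · intro l _ l' _ h
        simpa using h
    simp only [hS]
    rw [lintegral_finsetSum' _ fun k hk =>
      Finset.aemeasurable_fun_sum _ fun l hl => hTm n k hk l hl]
    calc ∑ k ∈ dyadicIndex ι n, ∫⁻ ω, ∑ l ∈ dyadicIndex ι n, T n k l ω ∂P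
        ≤ ∑ k ∈ dyadicIndex ι n, (dyadicOffset ι).card *
            (ENNReal.ofReal ((θ ^ p)⁻¹ ^ n) * (M * ENNReal.ofReal (η ^ n))) := by
          refine Finset.sum_le_sum fun k hk => ?_
          rw [lintegral_finsetSum' _ fun l hl => hTm n k hk l hl]
          refine (Finset.sum_le_sum fun l hl => hTint k hk l hl).trans ?_
          rw [← Finset.sum_filter, Finset.sum_const, nsmul_eq_mul]
          exact mul_le_mul' (by exact_mod_cast hcount k) le_rfl
      _ = (dyadicOffset ι).card * M * c ^ n := by
          rw [Finset.sum_const, card_dyadicIndex, nsmul_eq_mul]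
          have : c ^ n = ((2 ^ n) ^ Fintype.card ι : ℕ) *
              (ENNReal.ofReal ((θ ^ p)⁻¹ ^ n) * ENNReal.ofReal (η ^ n)) := by
            rw [hc, ← ENNReal.ofReal_pow (by positivity), ← ENNReal.ofReal_mul (by positivity),
              ← ENNReal.ofReal_natCast, ← ENNReal.ofReal_mul (by positivity)]
            congr 1
            push_cast
            rw [div_eq_mul_inv, mul_pow, mul_pow, ← pow_mul, ← pow_mul, mul_comm n]
            ring
          rw [this]
          ring
  have hfin : ∫⁻ ω, ∑' n, S n ω ∂P < ⊤ := by
    rw [lintegral_tsum hSm]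
    refine (ENNReal.tsum_le_tsum hSint).trans_lt ?_
    rw [ENNReal.tsum_mul_left, ENNReal.tsum_geometric]
    refine ENNReal.mul_lt_top (ENNReal.mul_lt_top (by simp) hM.lt_top) ?_
    rw [ENNReal.inv_lt_top]
    exact tsub_pos_of_lt hc1
  filter_upwards [ae_lt_top' (AEMeasurable.tsum hSm) hfin.ne] with ω hω
  set R := ∑' n, S n ω with hR
  refine uniformContinuousOn_dyadicCube (C := R.toReal ^ ((p : ℝ)⁻¹)) (θ := θ)
    (by positivity) hθ hθ1 fun n k hk l hl hkl => ?_
  have h1 : T n k l ω ≤ R :=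
    calc T n k l ω ≤ ∑ l ∈ dyadicIndex ι n, T n k l ω :=
          Finset.single_le_sum_of_canonicallyOrdered (f := fun l => T n k l ω) hl
      _ ≤ S n ω := Finset.single_le_sum_of_canonicallyOrdered
          (f := fun k => ∑ l ∈ dyadicIndex ι n, T n k l ω) hk
      _ ≤ R := ENNReal.le_tsum n
  simp only [hT, if_pos hkl] at h1
  have h2 := ENNReal.toReal_mono hω.ne h1
  rw [ENNReal.toReal_mul, ENNReal.toReal_ofReal (by positivity), ENNReal.toReal_pow,
    toReal_enorm, Real.norm_eq_abs] at h2
  set D := |X (dyadicPt n l) ω - X (dyadicPt n k) ω| with hD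
  have h3 : D ^ p ≤ R.toReal * (θ ^ n) ^ p := by
    rw [← pow_mul, mul_comm n p, pow_mul]
    rw [inv_pow, inv_mul_le_iff₀ (by positivity)] at h2
    linarith
  have h4 : R.toReal * (θ ^ n) ^ p = (R.toReal ^ ((p : ℝ)⁻¹) * θ ^ n) ^ p := by
    rw [mul_pow, Real.rpow_inv_natCast_pow ENNReal.toReal_nonneg hp]
  rw [h4] at h3
  exact le_of_pow_le_pow_left₀ hp (by positivity) h3

end Dyadic

/-! ### Gaussian increments -/

variable {Ω : Type*} [MeasurableSpace Ω] {P : Measure Ω}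

/-- The absolute moments of a centred Gaussian variable are controlled by its second moment. -/
theorem lintegral_enorm_pow_le_of_hasGaussianLaw {D : Ω → ℝ} (hD : HasGaussianLaw D P)
    (hmean : ∫ ω, D ω ∂P = 0) {σ : ℝ} (hσ : 0 ≤ σ) (hvar : ∫ ω, D ω ^ 2 ∂P ≤ σ ^ 2) (p : ℕ) :
    ∫⁻ ω, ‖D ω‖ₑ ^ p ∂P ≤
      (∫⁻ x, ‖x‖ₑ ^ p ∂gaussianReal 0 1) * ENNReal.ofReal (σ ^ p) := by
  have hlaw := hD.map_eq_gaussianReal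
  rw [hmean] at hlaw
  set v := Var[D; P] with hv
  have hv0 : 0 ≤ v := variance_nonneg _ _
  have hvσ : √v ≤ σ := by
    rw [Real.sqrt_le_left hσ, hv, variance_of_integral_eq_zero hD.aemeasurable hmean]
    exact hvar
  have hscale : gaussianReal 0 v.toNNReal = (gaussianReal 0 1).map (√v * ·) := by
    rw [gaussianReal_map_const_mul, mul_zero, mul_one]
    congr 1
    ext
    simp [Real.sq_sqrt hv0, hv0]
  have h1 : ∫⁻ ω, ‖D ω‖ₑ ^ p ∂P = ∫⁻ x, ‖x‖ₑ ^ p ∂(P.map D) := by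
    rw [lintegral_map' (by fun_prop) hD.aemeasurable]
  rw [h1, hlaw, hscale, lintegral_map (by fun_prop) (by fun_prop)]
  have h2 : ∀ x : ℝ, ‖√v * x‖ₑ ^ p = ENNReal.ofReal (√v ^ p) * ‖x‖ₑ ^ p := by
    intro x
    rw [enorm_mul, mul_pow, Real.enorm_of_nonneg (Real.sqrt_nonneg v),
      ENNReal.ofReal_pow (Real.sqrt_nonneg v)]
  simp_rw [h2]
  rw [lintegral_const_mul _ (by fun_prop), mul_comm]
  gcongr

theorem lintegral_enorm_pow_gaussianReal_ne_top {p : ℕ} (hp : p ≠ 0) :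
    ∫⁻ x, ‖x‖ₑ ^ p ∂gaussianReal 0 1 ≠ ⊤ := by
  have h := memLp_id_gaussianReal (μ := 0) (v := 1) (p : NNReal)
  have h2 := lintegral_rpow_enorm_lt_top_of_eLpNorm_lt_top (by simpa using hp) (by simp) h.2
  simpa using h2.ne

/-- A process with centred Gaussian increments whose standard deviation is Hölder continuous has
almost surely uniformly continuous paths on the dyadic points of the unit cube. -/
theorem ae_uniformContinuousOn_dyadicCube_of_gaussian {ι : Type*} [Fintype ι] [DecidableEq ι]
    {X : (ι → ℝ) → Ω → ℝ} {K α : ℝ} (hK : 0 ≤ K) (hα : 0 < α)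
    (hXm : ∀ x ∈ dyadicCube ι, AEMeasurable (X x) P)
    (hG : ∀ x ∈ dyadicCube ι, ∀ y ∈ dyadicCube ι, HasGaussianLaw (fun ω => X x ω - X y ω) P)
    (hmean : ∀ x ∈ dyadicCube ι, ∀ y ∈ dyadicCube ι, ∫ ω, (X x ω - X y ω) ∂P = 0)
    (hvar : ∀ x ∈ dyadicCube ι, ∀ y ∈ dyadicCube ι,
      ∫ ω, (X x ω - X y ω) ^ 2 ∂P ≤ (K * dist x y ^ α) ^ 2) :
    ∀ᵐ ω ∂P, UniformContinuousOn (fun x => X x ω) (dyadicCube ι) := by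
  set r : ℝ := (1 / 2) ^ α with hr
  have hr0 : 0 < r := by positivity
  have hr1 : r < 1 := Real.rpow_lt_one (by norm_num) (by norm_num) hα
  -- a moment high enough to beat the dimension
  obtain ⟨p, hp, hpr⟩ : ∃ p : ℕ, p ≠ 0 ∧ 2 ^ Fintype.card ι * r ^ p < 1 := by
    have h := (tendsto_pow_atTop_nhds_zero_of_lt_one hr0.le hr1).const_mul
      ((2 : ℝ) ^ Fintype.card ι)
    rw [mul_zero] at h
    obtain ⟨p, h1, h2⟩ := ((h.eventually (gt_mem_nhds one_pos)).and (eventually_ne_atTop 0)).exists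
    exact ⟨p, h2, h1⟩
  refine ae_uniformContinuousOn_dyadicCube hp (η := r ^ p)
    (M := (∫⁻ x, ‖x‖ₑ ^ p ∂gaussianReal 0 1) * ENNReal.ofReal (K ^ p)) (by positivity) hpr
    (ENNReal.mul_ne_top (lintegral_enorm_pow_gaussianReal_ne_top hp) ENNReal.ofReal_ne_top) hXm
    fun n k hk l hl hkl => ?_
  have hl' : dyadicPt n l ∈ dyadicCube ι := ⟨n, l, hl, rfl⟩
  have hk' : dyadicPt n k ∈ dyadicCube ι := ⟨n, k, hk, rfl⟩
  have hd : dist (dyadicPt n l) (dyadicPt n k) ^ α ≤ r ^ n := by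
    have h1 : ((1 / 2 : ℝ) ^ n) ^ α = r ^ n := by
      rw [hr, ← Real.rpow_natCast, ← Real.rpow_natCast, ← Real.rpow_mul (by norm_num),
        ← Real.rpow_mul (by norm_num), mul_comm]
    rw [← h1]
    exact Real.rpow_le_rpow dist_nonneg (dist_dyadicPt_le hkl) hα.le
  have h := lintegral_enorm_pow_le_of_hasGaussianLaw (hG _ hl' _ hk') (hmean _ hl' _ hk')
    (σ := K * r ^ n) (by positivity) ((hvar _ hl' _ hk').trans (by gcongr)) p
  refine h.trans (le_of_eq ?_)
  rw [mul_pow, ENNReal.ofReal_mul (by positivity), mul_assoc, ← pow_mul, ← pow_mul, mul_comm n p]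

/-! ### Continuously differentiable functions from dyadic difference quotients -/

theorem exists_continuousOn_closure_of_uniformContinuousOn {X : Type*} [UniformSpace X]
    {A : Set X} {f : X → ℝ} (hf : UniformContinuousOn f A) :
    ∃ g : X → ℝ, ContinuousOn g (closure A) ∧ Set.EqOn g f A := by
  refine ⟨extendFrom A f, continuousOn_extendFrom le_rfl fun x hx => ?_,
    fun x hx => extendFrom_extends hf.continuousOn x hx⟩
  have := mem_closure_iff_nhdsWithin_neBot.1 hx
  have hc : Cauchy (𝓝[A] x) := cauchy_nhds.mono nhdsWithin_le_nhds
  exact CompleteSpace.complete (hc.map_of_le hf inf_le_right)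

section

variable {ι : Type*}

theorem tendsto_dyadicPt_dyadicCeil (x : ι → ℝ) :
    Tendsto (fun n => dyadicPt n (dyadicCeil n x)) atTop (𝓝 x) := by
  refine tendsto_pi_nhds.2 fun j => ?_
  have h0 : Tendsto (fun n : ℕ => x j + (1 / 2 : ℝ) ^ n) atTop (𝓝 (x j)) := by
    simpa using (tendsto_pow_atTop_nhds_zero_of_lt_one (r := (1 / 2 : ℝ)) (by norm_num)
      (by norm_num)).const_add (x j)
  refine tendsto_of_tendsto_of_tendsto_of_le_of_le tendsto_const_nhds h0 (fun n => ?_) fun n => ?_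
  · simp only [dyadicPt, dyadicCeil]
    rw [le_div_iff₀ (by positivity), mul_comm]
    exact Int.le_ceil _
  · simp only [dyadicPt, dyadicCeil]
    rw [div_le_iff₀ (by positivity), add_mul, ← mul_pow, mul_comm (x j)]
    have := (Int.ceil_lt_add_one ((2 : ℝ) ^ n * x j)).le
    simpa using this

variable (ι) in
/-- The open unit cube. -/
def openCube : Set (ι → ℝ) := Set.univ.pi fun _ => Set.Ioo 0 1

theorem isOpen_openCube [Finite ι] : IsOpen (openCube ι) :=
  isOpen_set_pi Set.finite_univ fun _ _ => isOpen_Ioo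

/-- The point `(x, h)` of `ℝ^ι × ℝ`, with the extra coordinate `h` indexed by `none`. -/
def extendCoord (x : ι → ℝ) (h : ℝ) : Option ι → ℝ := fun o => o.elim h x

theorem dist_extendCoord_lt [Fintype ι] {x y : ι → ℝ} {h k δ : ℝ} (hxy : dist x y < δ)
    (hhk : |h - k| < δ) : dist (extendCoord x h) (extendCoord y k) < δ := by
  have hδ : 0 < δ := dist_nonneg.trans_lt hxy
  refine (dist_pi_lt_iff hδ).2 fun o => ?_
  cases o with
  | none => simpa [extendCoord, Real.dist_eq] using hhk
  | some i => exact (dist_le_pi_dist x y i).trans_lt hxy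

variable [Fintype ι] [DecidableEq ι]

theorem dyadicPt_dyadicCeil_mem {x : ι → ℝ} (hx : ∀ j, 0 < x j ∧ x j ≤ 1) (n : ℕ) :
    dyadicPt n (dyadicCeil n x) ∈ dyadicCube ι :=
  ⟨n, _, dyadicCeil_mem hx, rfl⟩

theorem Icc_subset_closure_dyadicCube :
    (Set.univ.pi fun _ => Set.Icc 0 1 : Set (ι → ℝ)) ⊆ closure (dyadicCube ι) := by
  have h1 : (Set.univ.pi fun _ => Set.Ioc 0 1 : Set (ι → ℝ)) ⊆ closure (dyadicCube ι) :=
    fun x hx => mem_closure_of_tendsto (tendsto_dyadicPt_dyadicCeil x)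
      (.of_forall fun n => dyadicPt_dyadicCeil_mem (fun j => hx j trivial) n)
  have h2 := closure_minimal h1 isClosed_closure
  rw [closure_pi_set] at h2
  simpa [closure_Ioc (zero_ne_one' ℝ)] using h2

/-- The difference quotient of `f` in the `i`-th coordinate direction, as a function of the base
point and the increment jointly. -/
noncomputable def quotientFun (f : (ι → ℝ) → ℝ) (i : ι) (z : Option ι → ℝ) : ℝ :=
  (f ((fun j => z (some j)) + Pi.single i (z none)) - f fun j => z (some j)) / z none

/-- Increments along one coordinate axis, from a base point near `x₀`. Only positive increments
are assumed to be controlled, as the quotient with increment `-h` at `x` is the quotient with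
increment `h` at `x - h eᵢ`. -/
theorem abs_sub_sub_le_of_quotient {g : (ι → ℝ) → ℝ} {O : Set (ι → ℝ)} (hO : IsOpen O)
    {i : ι} {G : (Option ι → ℝ) → ℝ} {D : Set (Option ι → ℝ)}
    (hD : ∀ x ∈ O, ∀ h, 0 ≤ h → h < 1 → extendCoord x h ∈ D) (hG : ContinuousOn G D)
    (hgG : ∀ x ∈ O, ∀ h, 0 < h → h < 1 → x + Pi.single i h ∈ O →
      h * G (extendCoord x h) = g (x + Pi.single i h) - g x)
    {x₀ : ι → ℝ} (hx₀ : x₀ ∈ O) {c : ℝ} (hc : 0 < c) :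
    ∃ δ > 0, ∀ (x : ι → ℝ) (h : ℝ), dist x x₀ < δ → |h| < δ →
      |g (x + Pi.single i h) - g x - G (extendCoord x₀ 0) * h| ≤ c * |h| := by
  obtain ⟨r, hr, hrO⟩ := Metric.isOpen_iff.1 hO x₀ hx₀
  obtain ⟨δ, hδ, hδG⟩ := Metric.continuousOn_iff.1 hG (extendCoord x₀ 0)
    (hD x₀ hx₀ 0 le_rfl one_pos) c hc
  obtain ⟨δ', hδ'0, e1, e2, e3⟩ : ∃ δ' > 0, δ' ≤ δ / 2 ∧ δ' ≤ r / 2 ∧ δ' ≤ 1 :=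
    ⟨min (min (δ / 2) (r / 2)) 1, by positivity, (min_le_left _ _).trans (min_le_left _ _),
      (min_le_left _ _).trans (min_le_right _ _), min_le_right _ _⟩
  have hpos : ∀ (x : ι → ℝ) (h : ℝ), dist x x₀ < 2 * δ' →
      dist (x + Pi.single i h) x₀ < 2 * δ' → 0 < h → h < δ' →
        |g (x + Pi.single i h) - g x - G (extendCoord x₀ 0) * h| ≤ c * |h| := by
    intro x h hx hxh h0 hh
    have hxO : x ∈ O := hrO (Metric.mem_ball.2 (by linarith))
    have hxhO : x + Pi.single i h ∈ O := hrO (Metric.mem_ball.2 (by linarith))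
    have h1 : h < 1 := by linarith
    rw [← hgG x hxO h h0 h1 hxhO]
    have h3 : dist (extendCoord x h) (extendCoord x₀ 0) < δ :=
      dist_extendCoord_lt (by linarith) (by rw [sub_zero, abs_of_pos h0]; linarith)
    have h2 := hδG _ (hD x hxO h h0.le h1) h3
    rw [Real.dist_eq] at h2
    rw [mul_comm (G (extendCoord x₀ 0)), ← mul_sub, abs_mul, mul_comm]
    exact mul_le_mul_of_nonneg_right h2.le (abs_nonneg h)
  refine ⟨δ', hδ'0, fun x h hx hh => ?_⟩
  have hxh : dist (x + Pi.single i h) x₀ < 2 * δ' := by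
    have : dist (x + Pi.single i h) x ≤ |h| := by
      rw [dist_self_add_left, Pi.norm_single, Real.norm_eq_abs]
    linarith [dist_triangle (x + Pi.single i h) x x₀]
  rcases lt_trichotomy h 0 with h0 | h0 | h0
  · have hx2 : dist x x₀ < 2 * δ' := by linarith
    have hh2 : -h < δ' := by rwa [abs_of_neg h0] at hh
    obtain ⟨y, hy⟩ : ∃ y : ι → ℝ, y = x + Pi.single i h := ⟨_, rfl⟩
    have e4 : y + Pi.single i (-h) = x := by
      rw [hy, add_assoc, ← Pi.single_add, add_neg_cancel, Pi.single_zero, add_zero]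
    rw [← hy] at hxh ⊢
    have h5 := hpos y (-h) hxh (by rw [e4]; exact hx2) (neg_pos.2 h0) hh2
    rw [e4, abs_neg, ← abs_neg] at h5
    refine le_of_eq_of_le (congrArg _ ?_) h5
    ring
  · simp [h0]
  · exact hpos x h (by linarith) hxh h0 (by rwa [abs_of_pos h0] at hh)

/-- A function whose partial difference quotients are given by functions continuous up to
increment zero has a total derivative. -/
theorem hasFDerivAt_of_quotients {g : (ι → ℝ) → ℝ} {O : Set (ι → ℝ)} (hO : IsOpen O)
    {G : ι → (Option ι → ℝ) → ℝ} {D : Set (Option ι → ℝ)}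
    (hD : ∀ x ∈ O, ∀ h, 0 ≤ h → h < 1 → extendCoord x h ∈ D)
    (hG : ∀ i, ContinuousOn (G i) D)
    (hgG : ∀ i, ∀ x ∈ O, ∀ h, 0 < h → h < 1 → x + Pi.single i h ∈ O →
      h * G i (extendCoord x h) = g (x + Pi.single i h) - g x)
    {x₀ : ι → ℝ} (hx₀ : x₀ ∈ O) :
    HasFDerivAt g
      (∑ i, G i (extendCoord x₀ 0) • ContinuousLinearMap.proj (R := ℝ) (φ := fun _ => ℝ) i)
      x₀ := by
  set d : ι → ℝ := fun i => G i (extendCoord x₀ 0) with hd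
  have hstep : ∀ i, ∀ c > 0, ∃ δ > 0, ∀ (x : ι → ℝ) (h : ℝ), dist x x₀ < δ → |h| < δ →
      |g (x + Pi.single i h) - g x - d i * h| ≤ c * |h| := fun i c hc =>
    abs_sub_sub_le_of_quotient hO hD (hG i) (hgG i) hx₀ hc
  rw [hasFDerivAt_iff_isLittleO_nhds_zero, Asymptotics.isLittleO_iff]
  intro c hc
  set c' := c / (Fintype.card ι + 1) with hc'
  have hc'0 : 0 < c' := by positivity
  choose δ hδ hδs using fun i => hstep i c' hc'0
  have hev : ∀ᶠ v in 𝓝 (0 : ι → ℝ), ∀ i, ‖v‖ < δ i := by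
    refine eventually_all.2 fun i => ?_
    have := Metric.ball_mem_nhds (0 : ι → ℝ) (hδ i)
    filter_upwards [this] with v hv
    simpa using hv
  filter_upwards [hev] with v hv
  -- move from `x₀` to `x₀ + v` one coordinate at a time
  have htel : ∀ s : Finset ι,
      |g (x₀ + s.piecewise v 0) - g x₀ - ∑ i ∈ s, d i * v i| ≤ s.card * (c' * ‖v‖) := by
    intro s
    induction s using Finset.induction_on with
    | empty => simp
    | insert i s hi ih =>
      have hins : x₀ + (insert i s).piecewise v 0 = (x₀ + s.piecewise v 0) + Pi.single i (v i) := by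
        ext j
        simp only [Pi.add_apply, Finset.piecewise, Finset.mem_insert, Pi.single_apply]
        by_cases hj : j = i
        · subst hj
          simp [hi]
        · simp [hj]
      have hnear : dist (x₀ + s.piecewise v 0) x₀ < δ i := by
        rw [dist_self_add_left]
        refine lt_of_le_of_lt ?_ (hv i)
        refine (pi_norm_le_iff_of_nonneg (norm_nonneg _)).2 fun j => ?_
        by_cases hj : j ∈ s
        · simpa [Finset.piecewise, hj] using norm_le_pi_norm v j
        · simp [Finset.piecewise, hj]
      have hvi : |v i| ≤ ‖v‖ := norm_le_pi_norm v i
      have h1 := hδs i (x₀ + s.piecewise v 0) (v i) hnear (hvi.trans_lt (hv i))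
      have h2 : c' * |v i| ≤ c' * ‖v‖ := by gcongr
      rw [hins, Finset.sum_insert hi, Finset.card_insert_of_notMem hi]
      push_cast
      have h3 := abs_add_le (g (x₀ + s.piecewise v 0 + Pi.single i (v i)) - g (x₀ + s.piecewise v 0)
        - d i * v i) (g (x₀ + s.piecewise v 0) - g x₀ - ∑ i ∈ s, d i * v i)
      have h4 : g (x₀ + s.piecewise v 0 + Pi.single i (v i)) - g x₀
          - (d i * v i + ∑ i ∈ s, d i * v i) =
          (g (x₀ + s.piecewise v 0 + Pi.single i (v i)) - g (x₀ + s.piecewise v 0)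
        - d i * v i) + (g (x₀ + s.piecewise v 0) - g x₀ - ∑ i ∈ s, d i * v i) := by ring
      rw [h4]
      linarith
  have h := htel Finset.univ
  rw [Finset.piecewise_univ] at h
  have hval : (∑ i, d i • ContinuousLinearMap.proj (R := ℝ) (φ := fun _ : ι => ℝ) i) v
      = ∑ i, d i * v i := by
    simp
  rw [hval, Real.norm_eq_abs]
  refine h.trans ?_
  have h5 : (Finset.univ : Finset ι).card * (c' * ‖v‖) = (Fintype.card ι * c') * ‖v‖ := by
    rw [Finset.card_univ]; ring
  rw [h5]
  have h6 : Fintype.card ι * c' ≤ c := by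
    rw [hc', mul_div_assoc', div_le_iff₀ (by positivity)]
    nlinarith
  gcongr

/-- If `f` and its partial difference quotients, as functions of base point and increment jointly,
are uniformly continuous on dyadic points, then `f` extends from the dyadic points to a
continuously differentiable function. -/
theorem exists_contDiffOn_of_uniformContinuousOn {f : (ι → ℝ) → ℝ}
    (hf : UniformContinuousOn f (dyadicCube ι))
    (hq : ∀ i, UniformContinuousOn (quotientFun f i) (dyadicCube (Option ι))) :
    ∃ g : (ι → ℝ) → ℝ, ContDiffOn ℝ 1 g (openCube ι) ∧
      ∀ x ∈ openCube ι, Tendsto (fun n => f (dyadicPt n (dyadicCeil n x))) atTop (𝓝 (g x)) := by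
  obtain ⟨g, hgc, hgf⟩ := exists_continuousOn_closure_of_uniformContinuousOn hf
  choose G hGc hGf using fun i => exists_continuousOn_closure_of_uniformContinuousOn (hq i)
  have hunit : ∀ x ∈ openCube ι, ∀ j, 0 < x j ∧ x j ≤ 1 := fun x hx j =>
    ⟨(hx j trivial).1, (hx j trivial).2.le⟩
  have hlim : ∀ x ∈ openCube ι,
      Tendsto (fun n => f (dyadicPt n (dyadicCeil n x))) atTop (𝓝 (g x)) := by
    intro x hx
    have hxc : x ∈ closure (dyadicCube ι) :=
      Icc_subset_closure_dyadicCube fun j _ => ⟨(hx j trivial).1.le, (hx j trivial).2.le⟩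
    have h1 : Tendsto (fun n => dyadicPt n (dyadicCeil n x)) atTop (𝓝[closure (dyadicCube ι)] x) :=
      tendsto_nhdsWithin_iff.2 ⟨tendsto_dyadicPt_dyadicCeil x,
        .of_forall fun n => subset_closure (dyadicPt_dyadicCeil_mem (hunit x hx) n)⟩
    refine ((hgc x hxc).tendsto.comp h1).congr fun n => ?_
    exact hgf (dyadicPt_dyadicCeil_mem (hunit x hx) n)
  have hgO : ContinuousOn g (openCube ι) := hgc.mono fun x hx =>
    Icc_subset_closure_dyadicCube fun j _ => ⟨(hx j trivial).1.le, (hx j trivial).2.le⟩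
  have hD : ∀ x ∈ openCube ι, ∀ h : ℝ, 0 ≤ h → h < 1 →
      extendCoord x h ∈ closure (dyadicCube (Option ι)) := by
    intro x hx h h0 h1
    refine Icc_subset_closure_dyadicCube fun o _ => ?_
    cases o with
    | none => exact ⟨h0, h1.le⟩
    | some j => exact ⟨(hx j trivial).1.le, (hx j trivial).2.le⟩
  have hgG : ∀ i, ∀ x ∈ openCube ι, ∀ h, 0 < h → h < 1 → x + Pi.single i h ∈ openCube ι →
      h * G i (extendCoord x h) = g (x + Pi.single i h) - g x := by
    intro i x hx h h0 h1 hxh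
    set z := extendCoord x h with hz
    have hzu : ∀ o, 0 < z o ∧ z o ≤ 1 := by
      intro o
      cases o with
      | none => exact ⟨h0, h1.le⟩
      | some j => exact hunit x hx j
    set zn : ℕ → Option ι → ℝ := fun n => dyadicPt n (dyadicCeil n z) with hzn
    have hzlim : Tendsto zn atTop (𝓝 z) := tendsto_dyadicPt_dyadicCeil z
    have hzmem : ∀ n, zn n ∈ dyadicCube (Option ι) := fun n => dyadicPt_dyadicCeil_mem hzu n
    have hGlim : Tendsto (fun n => quotientFun f i (zn n)) atTop (𝓝 (G i z)) := by
      have h2 : Tendsto zn atTop (𝓝[closure (dyadicCube (Option ι))] z) :=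
        tendsto_nhdsWithin_iff.2 ⟨hzlim, .of_forall fun n => subset_closure (hzmem n)⟩
      exact ((hGc i z (hD x hx h h0.le h1)).tendsto.comp h2).congr fun n => hGf i (hzmem n)
    have hhlim : Tendsto (fun n => zn n none) atTop (𝓝 h) := (tendsto_pi_nhds.1 hzlim) none
    -- the shifted dyadic point is a dyadic point of the same level
    set k : ℕ → ι → ℤ := fun n => dyadicCeil n x + Pi.single i (dyadicCeil n z none) with hk
    have hkpt : ∀ n, (fun j => zn n (some j)) + Pi.single i (zn n none) = dyadicPt n (k n) := by
      intro n
      ext j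
      simp only [hzn, hk, dyadicPt, Pi.add_apply, Pi.single_apply]
      split_ifs
      · push_cast
        rw [add_div]
        rfl
      · push_cast
        rw [add_zero, add_zero]
        rfl
    have hklim : Tendsto (fun n => dyadicPt n (k n)) atTop (𝓝 (x + Pi.single i h)) := by
      simp_rw [← hkpt]
      refine tendsto_pi_nhds.2 fun j => ?_
      simp only [Pi.add_apply]
      refine ((tendsto_pi_nhds.1 hzlim) (some j)).add ?_
      simp only [Pi.single_apply]
      split_ifs
      · exact hhlim
      · exact tendsto_const_nhds
    have hkmem : ∀ᶠ n in atTop, dyadicPt n (k n) ∈ dyadicCube ι := by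
      filter_upwards [hklim.eventually (isOpen_openCube.mem_nhds hxh)] with n hn
      refine ⟨n, k n, mem_dyadicIndex.2 fun j => ?_, rfl⟩
      have h2 := hn j trivial
      simp only [dyadicPt, Set.mem_Ioo] at h2
      have hp : (0 : ℝ) < 2 ^ n := by positivity
      rw [div_pos_iff_of_pos_right hp, div_lt_one hp] at h2
      have h3 : (0 : ℤ) < k n j := by exact_mod_cast h2.1
      exact ⟨h3, by exact_mod_cast h2.2.le⟩
    have hglim : Tendsto (fun n => f (dyadicPt n (k n))) atTop (𝓝 (g (x + Pi.single i h))) := by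
      refine ((hgO.continuousAt (isOpen_openCube.mem_nhds hxh)).tendsto.comp hklim).congr' ?_
      filter_upwards [hkmem] with n hn
      exact hgf hn
    have h3 := hhlim.mul hGlim
    have h4 := hglim.sub (hlim x hx)
    refine tendsto_nhds_unique h3 (h4.congr fun n => ?_)
    have hn0 : zn n none ≠ 0 := (mem_unit_of_mem_dyadicCube (hzmem n) none).1.ne'
    simp only [quotientFun]
    rw [mul_div_cancel₀ _ hn0, hkpt]
    rfl
  have hder : ∀ x ∈ openCube ι, HasFDerivAt g
      (∑ i, G i (extendCoord x 0) • ContinuousLinearMap.proj (R := ℝ) (φ := fun _ : ι => ℝ) i)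
      x := fun x hx => hasFDerivAt_of_quotients isOpen_openCube hD hGc hgG hx
  refine ⟨g, ?_, hlim⟩
  rw [show (1 : WithTop ℕ∞) = 0 + 1 by simp, contDiffOn_succ_iff_fderiv_of_isOpen isOpen_openCube]
  refine ⟨fun x hx => (hder x hx).differentiableAt.differentiableWithinAt, by simp, ?_⟩
  rw [contDiffOn_zero]
  have hcont : ContinuousOn (fun x : ι → ℝ => ∑ i, G i (extendCoord x 0) •
      ContinuousLinearMap.proj (R := ℝ) (φ := fun _ : ι => ℝ) i) (openCube ι) := by
    refine continuousOn_finsetSum _ fun i _ => ContinuousOn.fun_smul ?_ continuousOn_const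
    refine (hGc i).comp ?_ fun x hx => hD x hx 0 le_rfl one_pos
    refine Continuous.continuousOn (continuous_pi fun o => ?_)
    cases o with
    | none => exact continuous_const
    | some j => exact continuous_apply j
  exact hcont.congr fun x hx => (hder x hx).fderiv

end

/-! ### The spectral isometry and `L²` bounds -/

/-- `Z` is, on `S`, a centred Gaussian random field with the Matérn covariance. -/
structure IsMaternField {Ω : Type*} [MeasurableSpace Ω] (P : Measure Ω) (S : Set E3) (ν a : ℝ)
    (Z : E3 → Ω → ℝ) : Prop where
  gauss : IsGaussianProcess (fun s : S => Z s) P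
  mean_eq_zero : ∀ s ∈ S, ∫ ω, Z s ω ∂P = 0
  cov_eq : ∀ s ∈ S, ∀ t ∈ S, cov[Z s, Z t; P] = matern ν a ‖s - t‖

theorem sq_norm_sum_mul_exp {κ : Type*} [Fintype κ] (c θ : κ → ℝ) :
    ‖∑ k, (c k : ℂ) * Complex.exp (θ k * Complex.I)‖ ^ 2 =
      ∑ k, ∑ l, c k * c l * Real.cos (θ k - θ l) := by
  have hre : (∑ k, (c k : ℂ) * Complex.exp (θ k * Complex.I)).re = ∑ k, c k * Real.cos (θ k) := by
    simp [Complex.exp_ofReal_mul_I_re]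
  have him : (∑ k, (c k : ℂ) * Complex.exp (θ k * Complex.I)).im = ∑ k, c k * Real.sin (θ k) := by
    simp [Complex.exp_ofReal_mul_I_im]
  rw [← Complex.normSq_eq_norm_sq, Complex.normSq_apply, hre, him, Finset.sum_mul_sum,
    Finset.sum_mul_sum, ← Finset.sum_add_distrib]
  refine Finset.sum_congr rfl fun k _ => ?_
  rw [← Finset.sum_add_distrib]
  refine Finset.sum_congr rfl fun l _ => ?_
  rw [Real.cos_sub]
  ring

namespace IsMaternField

variable {Ω : Type*} [MeasurableSpace Ω] {P : Measure Ω} {S : Set E3} {ν a : ℝ} {Z : E3 → Ω → ℝ}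

theorem hasGaussianLaw (hZ : IsMaternField P S ν a Z) {s : E3} (hs : s ∈ S) :
    HasGaussianLaw (Z s) P :=
  hZ.gauss.hasGaussianLaw_eval ⟨s, hs⟩

theorem memLp_two (hZ : IsMaternField P S ν a Z) {s : E3} (hs : s ∈ S) : MemLp (Z s) 2 P :=
  (hZ.hasGaussianLaw hs).memLp_two

theorem aemeasurable (hZ : IsMaternField P S ν a Z) {s : E3} (hs : s ∈ S) :
    AEMeasurable (Z s) P :=
  (hZ.hasGaussianLaw hs).aemeasurable

theorem integral_mul (hZ : IsMaternField P S ν a Z) {s t : E3} (hs : s ∈ S) (ht : t ∈ S) :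
    ∫ ω, Z s ω * Z t ω ∂P = matern ν a ‖s - t‖ := by
  have := hZ.gauss.isProbabilityMeasure
  rw [← hZ.cov_eq s hs t ht, covariance_eq_sub (hZ.memLp_two hs) (hZ.memLp_two ht),
    hZ.mean_eq_zero s hs]
  simp

variable {κ : Type*} [Fintype κ]

theorem hasGaussianLaw_sum (hZ : IsMaternField P S ν a Z) (c : κ → ℝ) {s : κ → E3}
    (hs : ∀ k, s k ∈ S) : HasGaussianLaw (fun ω => ∑ k, c k * Z (s k) ω) P :=
  ((hZ.gauss.comp_right fun k => ⟨s k, hs k⟩).smul c).hasGaussianLaw_fun_sum (I := Finset.univ)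

theorem integral_sum (hZ : IsMaternField P S ν a Z) (c : κ → ℝ) {s : κ → E3}
    (hs : ∀ k, s k ∈ S) : ∫ ω, ∑ k, c k * Z (s k) ω ∂P = 0 := by
  rw [integral_finsetSum _ fun k _ => ((hZ.hasGaussianLaw (hs k)).integrable).const_mul _]
  refine Finset.sum_eq_zero fun k _ => ?_
  rw [integral_const_mul, hZ.mean_eq_zero _ (hs k), mul_zero]

/-- The spectral isometry: `Z s ↦ exp(i ⟨·, s⟩)` preserves the `L²` norms of real linear
combinations. -/
theorem integral_sq_sum (hZ : IsMaternField P S ν a Z) (hν : 0 < ν) (ha : 0 < a) (c : κ → ℝ)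
    {s : κ → E3} (hs : ∀ k, s k ∈ S) :
    ∫ ω, (∑ k, c k * Z (s k) ω) ^ 2 ∂P =
      ∫ ξ, ‖∑ k, (c k : ℂ) * Complex.exp ((inner ℝ ξ (s k) : ℝ) * Complex.I)‖ ^ 2
        ∂maternSpectral E3 ν a := by
  have := isProbabilityMeasure_maternSpectral (E := E3) hν ha
  have hi : ∀ k l, Integrable (fun ω => Z (s k) ω * Z (s l) ω) P := fun k l =>
    (hZ.memLp_two (hs k)).integrable_mul (hZ.memLp_two (hs l))
  have hL : ∫ ω, (∑ k, c k * Z (s k) ω) ^ 2 ∂P =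
      ∑ k, ∑ l, c k * c l * matern ν a ‖s k - s l‖ := by
    have h1 : ∀ ω, (∑ k, c k * Z (s k) ω) ^ 2 =
        ∑ k, ∑ l, c k * c l * (Z (s k) ω * Z (s l) ω) := by
      intro ω
      rw [sq, Finset.sum_mul_sum]
      refine Finset.sum_congr rfl fun k _ => Finset.sum_congr rfl fun l _ => ?_
      ring
    simp_rw [h1]
    rw [integral_finsetSum _ fun k _ => integrable_finsetSum _ fun l _ => (hi k l).const_mul _]
    refine Finset.sum_congr rfl fun k _ => ?_
    rw [integral_finsetSum _ fun l _ => (hi k l).const_mul _]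
    refine Finset.sum_congr rfl fun l _ => ?_
    rw [integral_const_mul, hZ.integral_mul (hs k) (hs l)]
  have hcos : ∀ k l, Integrable
      (fun ξ : E3 => c k * c l * Real.cos (inner ℝ ξ (s k) - inner ℝ ξ (s l)))
      (maternSpectral E3 ν a) := fun k l => by
    refine Integrable.const_mul ((integrable_const (1 : ℝ)).mono' (by fun_prop)
      (ae_of_all _ fun ξ => ?_)) _
    exact Real.abs_cos_le_one _
  rw [hL]
  simp_rw [sq_norm_sum_mul_exp]
  rw [integral_finsetSum _ fun k _ => integrable_finsetSum _ fun l _ => hcos k l]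
  refine Finset.sum_congr rfl fun k _ => ?_
  rw [integral_finsetSum _ fun l _ => hcos k l]
  refine Finset.sum_congr rfl fun l _ => ?_
  rw [integral_const_mul]
  simp_rw [← inner_sub_right]
  rw [integral_cos_maternSpectral hν ha]

/-- A linear combination whose spectral transform is bounded by `B ‖ξ‖ ^ q` is controlled by the
spectral moment of order `2q`. -/
theorem integral_sq_sum_le (hZ : IsMaternField P S ν a Z) (hν : 0 < ν) (ha : 0 < a) (c : κ → ℝ)
    {s : κ → E3} (hs : ∀ k, s k ∈ S) {B q : ℝ} (hq : 0 ≤ q) (hqν : q < ν)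
    (hB : ∀ ξ : E3, ‖∑ k, (c k : ℂ) * Complex.exp ((inner ℝ ξ (s k) : ℝ) * Complex.I)‖
      ≤ B * ‖ξ‖ ^ q) :
    ∫ ω, (∑ k, c k * Z (s k) ω) ^ 2 ∂P ≤
      (√(∫ ξ, ‖ξ‖ ^ (2 * q) ∂maternSpectral E3 ν a) * B) ^ 2 := by
  have := isProbabilityMeasure_maternSpectral (E := E3) hν ha
  have h0 : 0 ≤ ∫ ξ, ‖ξ‖ ^ (2 * q) ∂maternSpectral E3 ν a :=
    integral_nonneg fun ξ => by positivity
  have hm := integrable_norm_rpow_maternSpectral (E := E3) hν ha (q := 2 * q) (by linarith)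
    (by linarith)
  rw [hZ.integral_sq_sum hν ha c hs, mul_pow, Real.sq_sqrt h0, mul_comm, ← integral_const_mul]
  refine integral_mono_of_nonneg (ae_of_all _ fun ξ => by positivity) (hm.const_mul _)
    (ae_of_all _ fun ξ => ?_)
  beta_reduce
  have h1 : B ^ 2 * ‖ξ‖ ^ (2 * q) = (B * ‖ξ‖ ^ q) ^ 2 := by
    rw [mul_pow, ← Real.rpow_natCast (‖ξ‖ ^ q), ← Real.rpow_mul (norm_nonneg _), mul_comm q]
    norm_num
  rw [h1]
  exact pow_le_pow_left₀ (norm_nonneg _) (hB ξ) 2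

end IsMaternField

theorem norm_exp_sub_exp_le (x y : ℝ) {α : ℝ} (hα : 0 ≤ α) (hα1 : α ≤ 1) :
    ‖Complex.exp (x * Complex.I) - Complex.exp (y * Complex.I)‖ ≤ 2 * |x - y| ^ α := by
  rcases le_or_gt |x - y| 1 with h | h
  · have h1 : Complex.exp (x * Complex.I) - Complex.exp (y * Complex.I) =
        Complex.exp (y * Complex.I) * (Complex.exp (Complex.I * ((x - y : ℝ) : ℂ)) - 1) := by
      rw [mul_sub, ← Complex.exp_add, mul_one]
      congr 2
      push_cast
      ring
    rw [h1, norm_mul, Complex.norm_exp_ofReal_mul_I, one_mul]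
    refine (Real.norm_exp_I_mul_ofReal_sub_one_le).trans ?_
    have h2 : |x - y| ≤ |x - y| ^ α := by
      conv_lhs => rw [← Real.rpow_one |x - y|]
      exact Real.rpow_le_rpow_of_exponent_ge' (abs_nonneg _) h hα hα1
    have h3 : 0 ≤ |x - y| ^ α := by positivity
    rw [Real.norm_eq_abs]
    linarith
  · refine (norm_sub_le _ _).trans ?_
    rw [Complex.norm_exp_ofReal_mul_I, Complex.norm_exp_ofReal_mul_I]
    have := Real.one_le_rpow h.le hα
    linarith

/-- Joint Hölder continuity of the difference quotients of `s ↦ exp(i ⟨ξ, s⟩)`, including in the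
increment. The quotient is an average of the derivative over the segment, so the mean value
inequality applies. -/
theorem norm_quotient_exp_sub_le (ξ s t u : E3) (hu : ‖u‖ = 1) {h k : ℝ} (hh : h ≠ 0) (hk : k ≠ 0)
    {α : ℝ} (hα : 0 ≤ α) (hα1 : α ≤ 1) :
    ‖((h⁻¹ : ℝ) : ℂ) * (Complex.exp ((inner ℝ ξ (s + h • u) : ℝ) * Complex.I)
        - Complex.exp ((inner ℝ ξ s : ℝ) * Complex.I))
      - ((k⁻¹ : ℝ) : ℂ) * (Complex.exp ((inner ℝ ξ (t + k • u) : ℝ) * Complex.I)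
        - Complex.exp ((inner ℝ ξ t : ℝ) * Complex.I))‖
      ≤ 2 * (‖s - t‖ + |h - k|) ^ α * ‖ξ‖ ^ (1 + α) := by
  set x : ℝ := inner ℝ ξ u with hx
  have hxξ : |x| ≤ ‖ξ‖ := by
    have := abs_real_inner_le_norm ξ u
    rwa [hu, mul_one] at this
  set A : ℝ → ℝ := fun r => inner ℝ ξ s + r * (h * x) with hA
  set B : ℝ → ℝ := fun r => inner ℝ ξ t + r * (k * x) with hB
  set φ : ℝ → ℂ := fun r => ((h⁻¹ : ℝ) : ℂ) * Complex.exp (A r * Complex.I)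
    - ((k⁻¹ : ℝ) : ℂ) * Complex.exp (B r * Complex.I) with hφ
  set φ' : ℝ → ℂ := fun r => x * Complex.I *
    (Complex.exp (A r * Complex.I) - Complex.exp (B r * Complex.I)) with hφ'
  have hAd : ∀ (c d r : ℝ), HasDerivAt
      (fun r : ℝ => Complex.exp (((c + r * d : ℝ) : ℂ) * Complex.I))
      (d * Complex.I * Complex.exp (((c + r * d : ℝ) : ℂ) * Complex.I)) r := by
    intro c d r
    have h1 : HasDerivAt (fun r : ℝ => c + r * d) d r := by
      simpa using ((hasDerivAt_id r).mul_const d).const_add c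
    have h2 := (h1.ofReal_comp.mul_const Complex.I).cexp
    convert h2 using 1
    ring
  have hder : ∀ r, HasDerivAt φ (φ' r) r := by
    intro r
    have h1 := ((hAd (inner ℝ ξ s) (h * x) r).const_mul ((h⁻¹ : ℝ) : ℂ)).sub
      ((hAd (inner ℝ ξ t) (k * x) r).const_mul ((k⁻¹ : ℝ) : ℂ))
    refine (show HasDerivAt φ _ r from h1).congr_deriv ?_
    have hh' : (h : ℂ) ≠ 0 := by exact_mod_cast hh
    have hk' : (k : ℂ) ≠ 0 := by exact_mod_cast hk
    simp only [hφ', hA, hB]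
    push_cast
    field_simp
  have hbound : ∀ r ∈ Set.Ico (0 : ℝ) 1,
      ‖φ' r‖ ≤ 2 * (‖s - t‖ + |h - k|) ^ α * ‖ξ‖ ^ (1 + α) := by
    intro r hr
    have h1 : |A r - B r| ≤ ‖ξ‖ * (‖s - t‖ + |h - k|) := by
      have e1 : A r - B r = inner ℝ ξ (s - t) + r * ((h - k) * x) := by
        simp only [hA, hB, inner_sub_right]
        ring
      rw [e1, mul_add]
      refine (abs_add_le _ _).trans (add_le_add (abs_real_inner_le_norm _ _) ?_)
      rw [abs_mul, abs_mul, abs_of_nonneg hr.1]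
      calc r * (|h - k| * |x|) ≤ 1 * (|h - k| * ‖ξ‖) := by
            gcongr
            exact hr.2.le
        _ = ‖ξ‖ * |h - k| := by ring
    have h2 := norm_exp_sub_exp_le (A r) (B r) hα hα1
    have h3 : |A r - B r| ^ α ≤ ‖ξ‖ ^ α * (‖s - t‖ + |h - k|) ^ α := by
      rw [← Real.mul_rpow (norm_nonneg _) (by positivity)]
      exact Real.rpow_le_rpow (abs_nonneg _) h1 hα
    have h4 : ‖φ' r‖ = |x| * ‖Complex.exp (A r * Complex.I) - Complex.exp (B r * Complex.I)‖ := by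
      simp only [hφ', norm_mul, Complex.norm_I, mul_one, Complex.norm_real, Real.norm_eq_abs]
    have h5 : ‖ξ‖ ^ (1 + α) = ‖ξ‖ * ‖ξ‖ ^ α := by
      rw [Real.rpow_add_of_nonneg (norm_nonneg _) zero_le_one hα, Real.rpow_one]
    rw [h4, h5]
    calc |x| * ‖Complex.exp (A r * Complex.I) - Complex.exp (B r * Complex.I)‖
        ≤ ‖ξ‖ * (2 * (‖ξ‖ ^ α * (‖s - t‖ + |h - k|) ^ α)) := by
          gcongr
          exact h2.trans (by gcongr)
      _ = _ := by ring
  have hmv := norm_image_sub_le_of_norm_deriv_le_segment_01'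
    (fun r _ => (hder r).hasDerivWithinAt) hbound
  refine le_of_eq_of_le (congrArg _ ?_) hmv
  simp only [hφ, hA, hB, inner_add_right, real_inner_smul_right, ← hx, one_mul, zero_mul, add_zero]
  ring

/-- The difference quotients of the field as combinations of four of its values. -/
theorem quotient_sub_eq_sum {Ω : Type*} (Z : E3 → Ω → ℝ) (s t u : E3) (h k : ℝ) (ω : Ω) :
    (Z (s + h • u) ω - Z s ω) / h - (Z (t + k • u) ω - Z t ω) / k =
      ∑ j, ![h⁻¹, -h⁻¹, -k⁻¹, k⁻¹] j * Z (![s + h • u, s, t + k • u, t] j) ω := by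
  simp only [Fin.sum_univ_four, Matrix.cons_val]
  ring

namespace IsMaternField

variable {Ω : Type*} [MeasurableSpace Ω] {P : Measure Ω} {S : Set E3} {ν a : ℝ} {Z : E3 → Ω → ℝ}

theorem integral_sq_sub_le (hZ : IsMaternField P S ν a Z) (hν : 0 < ν) (ha : 0 < a) {α : ℝ}
    (hα : 0 ≤ α) (hα1 : α ≤ 1) (hαν : α < ν) {s t : E3} (hs : s ∈ S) (ht : t ∈ S) :
    ∫ ω, (Z s ω - Z t ω) ^ 2 ∂P ≤
      (√(∫ ξ, ‖ξ‖ ^ (2 * α) ∂maternSpectral E3 ν a) * (2 * ‖s - t‖ ^ α)) ^ 2 := by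
  have h := hZ.integral_sq_sum_le hν ha ![1, -1] (s := ![s, t]) (by
    intro k; fin_cases k <;> simpa) hα hαν (B := 2 * ‖s - t‖ ^ α) (fun ξ => by
      have h1 := norm_exp_sub_exp_le (inner ℝ ξ s) (inner ℝ ξ t) hα hα1
      have h2 : |inner ℝ ξ s - inner ℝ ξ t| ^ α ≤ (‖ξ‖ * ‖s - t‖) ^ α := by
        rw [← inner_sub_right]
        exact Real.rpow_le_rpow (abs_nonneg _) (abs_real_inner_le_norm _ _) hα
      rw [Real.mul_rpow (norm_nonneg _) (norm_nonneg _)] at h2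
      simp only [Fin.sum_univ_two, Matrix.cons_val_zero, Matrix.cons_val_one]
      push_cast
      rw [one_mul, neg_one_mul, ← sub_eq_add_neg]
      refine h1.trans ?_
      linarith)
  simp only [Fin.sum_univ_two, Matrix.cons_val_zero, Matrix.cons_val_one, one_mul,
    neg_one_mul, ← sub_eq_add_neg] at h
  exact h

/-- The difference quotients are jointly Hölder continuous in `L²`, in base point and increment. -/
theorem integral_sq_quotient_sub_le (hZ : IsMaternField P S ν a Z) (hν : 0 < ν) (ha : 0 < a)
    {α : ℝ} (hα : 0 ≤ α) (hα1 : α ≤ 1) (hαν : 1 + α < ν) {s t u : E3} (hu : ‖u‖ = 1) {h k : ℝ}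
    (hh : h ≠ 0) (hk : k ≠ 0) (hs : s ∈ S) (hsh : s + h • u ∈ S) (ht : t ∈ S)
    (htk : t + k • u ∈ S) :
    ∫ ω, ((Z (s + h • u) ω - Z s ω) / h - (Z (t + k • u) ω - Z t ω) / k) ^ 2 ∂P ≤
      (√(∫ ξ, ‖ξ‖ ^ (2 * (1 + α)) ∂maternSpectral E3 ν a) *
        (2 * (‖s - t‖ + |h - k|) ^ α)) ^ 2 := by
  simp_rw [quotient_sub_eq_sum]
  refine hZ.integral_sq_sum_le hν ha _ (by
    intro j; fin_cases j <;> simpa) (by linarith) hαν (fun ξ => ?_)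
  refine le_of_eq_of_le (congrArg _ ?_) (norm_quotient_exp_sub_le ξ s t u hu hh hk hα hα1)
  simp only [Fin.sum_univ_four, Matrix.cons_val]
  push_cast
  ring

theorem hasGaussianLaw_quotient_sub (hZ : IsMaternField P S ν a Z) {s t u : E3} {h k : ℝ}
    (hs : s ∈ S) (hsh : s + h • u ∈ S) (ht : t ∈ S) (htk : t + k • u ∈ S) :
    HasGaussianLaw
      (fun ω => (Z (s + h • u) ω - Z s ω) / h - (Z (t + k • u) ω - Z t ω) / k) P := by
  simp_rw [quotient_sub_eq_sum]
  exact hZ.hasGaussianLaw_sum _ (by intro j; fin_cases j <;> simpa)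

theorem integral_quotient_sub (hZ : IsMaternField P S ν a Z) {s t u : E3} {h k : ℝ}
    (hs : s ∈ S) (hsh : s + h • u ∈ S) (ht : t ∈ S) (htk : t + k • u ∈ S) :
    ∫ ω, ((Z (s + h • u) ω - Z s ω) / h - (Z (t + k • u) ω - Z t ω) / k) ∂P = 0 := by
  simp_rw [quotient_sub_eq_sum]
  exact hZ.integral_sum _ (by intro j; fin_cases j <;> simpa)

end IsMaternField

/-! ### Local versions with continuously differentiable paths -/

/-- The affine chart of the unit cube with corner `s₀` and side `l`. -/
noncomputable def chart (s₀ : E3) (l : ℝ) (x : Fin 3 → ℝ) : E3 := s₀ + l • WithLp.toLp 2 x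

/-- The inverse of `chart`. -/
noncomputable def chartInv (s₀ : E3) (l : ℝ) (s : E3) : Fin 3 → ℝ := l⁻¹ • (s - s₀).ofLp

theorem chart_chartInv (s₀ : E3) {l : ℝ} (hl : l ≠ 0) (s : E3) :
    chart s₀ l (chartInv s₀ l s) = s := by
  rw [chart, chartInv, WithLp.toLp_smul, smul_smul, mul_inv_cancel₀ hl, one_smul, WithLp.toLp_ofLp]
  abel

theorem contDiff_chartInv (s₀ : E3) (l : ℝ) : ContDiff ℝ 1 (chartInv s₀ l) := by
  have h : ContDiff ℝ 1 fun s : E3 => (EuclideanSpace.equiv (Fin 3) ℝ) (s - s₀) :=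
    (EuclideanSpace.equiv (Fin 3) ℝ).contDiff.comp (contDiff_id.sub contDiff_const)
  exact h.const_smul l⁻¹

theorem norm_toLp_le (x : Fin 3 → ℝ) : ‖(WithLp.toLp 2 x : E3)‖ ≤ 2 * ‖x‖ := by
  refine le_of_sq_le_sq ?_ (by positivity)
  rw [EuclideanSpace.norm_sq_eq]
  calc ∑ i, ‖x i‖ ^ 2 ≤ ∑ _i : Fin 3, ‖x‖ ^ 2 :=
        Finset.sum_le_sum fun i _ => pow_le_pow_left₀ (norm_nonneg _) (norm_le_pi_norm x i) 2
    _ ≤ (2 * ‖x‖) ^ 2 := by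
        simp only [Finset.sum_const, Finset.card_univ, Fintype.card_fin, nsmul_eq_mul]
        push_cast
        nlinarith [sq_nonneg ‖x‖]

theorem norm_chart_sub_le (s₀ : E3) {l : ℝ} (hl : 0 ≤ l) (x y : Fin 3 → ℝ) :
    ‖chart s₀ l x - chart s₀ l y‖ ≤ 2 * l * dist x y := by
  have h : chart s₀ l x - chart s₀ l y = l • (WithLp.toLp 2 (x - y) : E3) := by
    rw [chart, chart, WithLp.toLp_sub, smul_sub]
    abel
  rw [h, norm_smul, Real.norm_of_nonneg hl, dist_eq_norm]
  calc l * ‖(WithLp.toLp 2 (x - y) : E3)‖ ≤ l * (2 * ‖x - y‖) := by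
        gcongr
        exact norm_toLp_le _
    _ = _ := by ring

theorem chart_add_single (s₀ : E3) (l : ℝ) (x : Fin 3 → ℝ) (i : Fin 3) (h : ℝ) :
    chart s₀ l (x + Pi.single i h) = chart s₀ l x + (l * h) • e i := by
  have : (WithLp.toLp 2 (Pi.single i h) : E3) = h • e i := by
    ext j
    simp [e, Pi.single_apply]
  rw [chart, chart, WithLp.toLp_add, this, smul_add, smul_smul]
  abel

/-- Around each point of an open set there is a small cube whose double stays in the set. -/
theorem exists_chart {S : Set E3} (hS : IsOpen S) {p : E3} (hp : p ∈ S) :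
    ∃ (s₀ : E3) (l : ℝ), 0 < l ∧ chartInv s₀ l p ∈ openCube (Fin 3) ∧
      ∀ x : Fin 3 → ℝ, (∀ j, 0 < x j ∧ x j ≤ 2) → chart s₀ l x ∈ S := by
  obtain ⟨r, hr, hrS⟩ := Metric.isOpen_iff.1 hS p hp
  set c : Fin 3 → ℝ := fun _ => 1 / 2 with hc
  have hl : 0 < r / 4 := by positivity
  set s₀ : E3 := p - (r / 4) • WithLp.toLp 2 c with hs₀
  have hpc : chart s₀ (r / 4) c = p := by
    rw [chart, hs₀]
    abel
  refine ⟨s₀, r / 4, hl, ?_, fun x hx => hrS ?_⟩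
  · have : chartInv s₀ (r / 4) p = c := by
      rw [chartInv, hs₀, sub_sub_cancel, WithLp.ofLp_smul, smul_smul, inv_mul_cancel₀ hl.ne',
        one_smul]
    rw [this]
    intro j _
    constructor <;> norm_num [hc]
  · rw [Metric.mem_ball, dist_eq_norm]
    nth_rewrite 1 [← hpc]
    refine (norm_chart_sub_le s₀ hl.le x c).trans_lt ?_
    have : dist x c ≤ 3 / 2 := by
      refine (dist_pi_le_iff (by norm_num)).2 fun j => ?_
      rw [Real.dist_eq, abs_le]
      have := hx j
      constructor <;> simp only [hc] <;> linarith
    nlinarith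

theorem eLpNorm_two_le_of_integral_sq_le {Ω : Type*} [MeasurableSpace Ω] {P : Measure Ω}
    {f : Ω → ℝ} (hf : MemLp f 2 P) {B : ℝ} (hB : 0 ≤ B) (h : ∫ ω, f ω ^ 2 ∂P ≤ B ^ 2) :
    eLpNorm f 2 P ≤ ENNReal.ofReal B := by
  rw [hf.eLpNorm_eq_integral_rpow_norm (by norm_num) (by norm_num)]
  refine ENNReal.ofReal_le_ofReal ?_
  simp only [ENNReal.toReal_ofNat, Real.rpow_ofNat, Real.norm_eq_abs, sq_abs]
  rw [← one_div, ← Real.sqrt_eq_rpow]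
  exact (Real.sqrt_le_left hB).2 h

theorem countable_dyadicCube (ι : Type*) [Fintype ι] [DecidableEq ι] :
    (dyadicCube ι).Countable := by
  have : dyadicCube ι ⊆ Set.range fun q : ℕ × (ι → ℤ) => dyadicPt q.1 q.2 := by
    rintro _ ⟨n, k, -, rfl⟩
    exact ⟨(n, k), rfl⟩
  exact (Set.countable_range _).mono this

namespace IsMaternField

variable {Ω : Type*} [MeasurableSpace Ω] {P : Measure Ω} {S : Set E3} {ν a : ℝ} {Z : E3 → Ω → ℝ}

theorem ae_uniformContinuousOn (hZ : IsMaternField P S ν a Z) (hν : 1 < ν) (ha : 0 < a) {s₀ : E3}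
    {l : ℝ} (hl : 0 < l)
    (hS : ∀ x : Fin 3 → ℝ, (∀ j, 0 < x j ∧ x j ≤ 2) → chart s₀ l x ∈ S) :
    ∀ᵐ ω ∂P, UniformContinuousOn (fun x => Z (chart s₀ l x) ω) (dyadicCube (Fin 3)) := by
  have hν0 : 0 < ν := by linarith
  have hmem : ∀ x ∈ dyadicCube (Fin 3), chart s₀ l x ∈ S := fun x hx => hS x fun j =>
    ⟨(mem_unit_of_mem_dyadicCube hx j).1, (mem_unit_of_mem_dyadicCube hx j).2.trans (by norm_num)⟩
  set C := √(∫ ξ, ‖ξ‖ ^ (2 * (1 : ℝ)) ∂maternSpectral E3 ν a) with hC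
  refine ae_uniformContinuousOn_dyadicCube_of_gaussian (K := C * (2 * (2 * l))) (α := 1)
    (by positivity) one_pos (fun x hx => hZ.aemeasurable (hmem x hx)) (fun x hx y hy => ?_)
    (fun x hx y hy => ?_) fun x hx y hy => ?_
  · exact hZ.gauss.hasGaussianLaw_fun_sub (s := ⟨_, hmem x hx⟩) (t := ⟨_, hmem y hy⟩)
  · rw [integral_sub (hZ.hasGaussianLaw (hmem x hx)).integrable
      (hZ.hasGaussianLaw (hmem y hy)).integrable, hZ.mean_eq_zero _ (hmem x hx),
      hZ.mean_eq_zero _ (hmem y hy), sub_zero]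
  · refine (hZ.integral_sq_sub_le hν0 ha (α := 1) zero_le_one le_rfl hν (hmem x hx)
      (hmem y hy)).trans ?_
    rw [Real.rpow_one, Real.rpow_one]
    have := norm_chart_sub_le s₀ hl.le x y
    rw [show C * (2 * (2 * l)) * dist x y = C * (2 * (2 * l * dist x y)) by ring]
    gcongr

theorem ae_uniformContinuousOn_quotientFun (hZ : IsMaternField P S ν a Z) (hν : 1 < ν)
    (ha : 0 < a) {s₀ : E3} {l : ℝ} (hl : 0 < l)
    (hS : ∀ x : Fin 3 → ℝ, (∀ j, 0 < x j ∧ x j ≤ 2) → chart s₀ l x ∈ S) (i : Fin 3) :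
    ∀ᵐ ω ∂P, UniformContinuousOn (quotientFun (fun x => Z (chart s₀ l x) ω) i)
      (dyadicCube (Option (Fin 3))) := by
  have hν0 : 0 < ν := by linarith
  -- a Hölder exponent allowed by the moments of the spectral measure
  obtain ⟨α, hα, hα1, hαν⟩ : ∃ α : ℝ, 0 < α ∧ α ≤ 1 ∧ 1 + α < ν :=
    ⟨min ((ν - 1) / 2) 1, lt_min (by linarith) one_pos, min_le_right _ _, by
      have := min_le_left ((ν - 1) / 2) 1
      linarith⟩
  set base : (Option (Fin 3) → ℝ) → Fin 3 → ℝ := fun z j => z (some j) with hbase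
  have hmem : ∀ z ∈ dyadicCube (Option (Fin 3)), chart s₀ l (base z) ∈ S := fun z hz =>
    hS _ fun j => ⟨(mem_unit_of_mem_dyadicCube hz _).1,
      (mem_unit_of_mem_dyadicCube hz _).2.trans (by norm_num)⟩
  have hmem' : ∀ z ∈ dyadicCube (Option (Fin 3)),
      chart s₀ l (base z) + (l * z none) • e i ∈ S := by
    intro z hz
    rw [← chart_add_single]
    refine hS _ fun j => ?_
    have h1 := mem_unit_of_mem_dyadicCube hz (some j)
    have h2 := mem_unit_of_mem_dyadicCube hz none
    simp only [hbase, Pi.add_apply, Pi.single_apply]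
    split_ifs <;> constructor <;> linarith
  have hne : ∀ z ∈ dyadicCube (Option (Fin 3)), l * z none ≠ 0 := fun z hz =>
    (mul_pos hl (mem_unit_of_mem_dyadicCube hz none).1).ne'
  set C := √(∫ ξ, ‖ξ‖ ^ (2 * (1 + α)) ∂maternSpectral E3 ν a) with hC
  have key := ae_uniformContinuousOn_dyadicCube_of_gaussian (P := P)
    (X := fun z ω => (Z (chart s₀ l (base z) + (l * z none) • e i) ω - Z (chart s₀ l (base z)) ω)
      / (l * z none)) (K := C * (2 * (3 * l) ^ α)) (α := α) (by positivity) hα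
    (fun z hz => ((hZ.aemeasurable (hmem' z hz)).sub (hZ.aemeasurable (hmem z hz))).div_const _)
    (fun z hz w hw => hZ.hasGaussianLaw_quotient_sub (hmem z hz) (hmem' z hz) (hmem w hw)
      (hmem' w hw))
    (fun z hz w hw => hZ.integral_quotient_sub (hmem z hz) (hmem' z hz) (hmem w hw)
      (hmem' w hw))
    (fun z hz w hw => by
      refine (hZ.integral_sq_quotient_sub_le hν0 ha hα.le hα1 hαν (norm_e i) (hne z hz) (hne w hw)
        (hmem z hz) (hmem' z hz) (hmem w hw) (hmem' w hw)).trans ?_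
      have h1 := norm_chart_sub_le s₀ hl.le (base z) (base w)
      have h2 : dist (base z) (base w) ≤ dist z w :=
        (dist_pi_le_iff dist_nonneg).2 fun j => dist_le_pi_dist z w (some j)
      have h3 : |l * z none - l * w none| ≤ l * dist z w := by
        rw [← mul_sub, abs_mul, abs_of_pos hl]
        gcongr
        exact dist_le_pi_dist z w none
      have h4 : ‖chart s₀ l (base z) - chart s₀ l (base w)‖ + |l * z none - l * w none|
          ≤ 3 * l * dist z w := by nlinarith
      rw [mul_assoc C, mul_assoc 2, ← Real.mul_rpow (by positivity) dist_nonneg]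
      gcongr)
  filter_upwards [key] with ω hω
  refine ((Real.uniformContinuous_const_mul (x := l)).comp_uniformContinuousOn hω).congr ?_
  intro z hz
  have hz0 : z none ≠ 0 := (mem_unit_of_mem_dyadicCube hz none).1.ne'
  simp only [Function.comp, quotientFun, chart_add_single, hbase]
  field_simp

/-- Locally, the field has a version with continuously differentiable paths: the limit of its
values at dyadic points. -/
theorem exists_local_version (hZ : IsMaternField P S ν a Z) (hν : 1 < ν) (ha : 0 < a)
    (hS : IsOpen S) {p : E3} (hp : p ∈ S) :
    ∃ U : Set E3, IsOpen U ∧ p ∈ U ∧ ∃ Z' : E3 → Ω → ℝ, (∀ s, Measurable (Z' s)) ∧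
      (∀ s ∈ U, Z' s =ᵐ[P] Z s) ∧ ∀ᵐ ω ∂P, ContDiffOn ℝ 1 (fun s => Z' s ω) U := by
  classical
  have hν0 : 0 < ν := by linarith
  obtain ⟨s₀, l, hl, hpl, hcS⟩ := exists_chart hS hp
  have hunit : ∀ x ∈ openCube (Fin 3), ∀ j, 0 < x j ∧ x j ≤ 1 := fun x hx j =>
    ⟨(hx j trivial).1, (hx j trivial).2.le⟩
  have hmem : ∀ x : Fin 3 → ℝ, (∀ j, 0 < x j ∧ x j ≤ 1) → chart s₀ l x ∈ S := fun x hx =>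
    hcS x fun j => ⟨(hx j).1, (hx j).2.trans (by norm_num)⟩
  set U : Set E3 := chartInv s₀ l ⁻¹' openCube (Fin 3) with hU
  have hUo : IsOpen U := isOpen_openCube.preimage (contDiff_chartInv s₀ l).continuous
  -- a measurable modification of the field
  set W : E3 → Ω → ℝ := fun s => if h : s ∈ S then (hZ.aemeasurable h).mk (Z s) else 0 with hW
  have hWm : ∀ s, Measurable (W s) := by
    intro s
    by_cases h : s ∈ S
    · simp only [hW, dif_pos h]
      exact (hZ.aemeasurable h).measurable_mk
    · simp only [hW, dif_neg h]
      exact measurable_const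
  have hWZ : ∀ s ∈ S, W s =ᵐ[P] Z s := by
    intro s h
    simp only [hW, dif_pos h]
    exact (hZ.aemeasurable h).ae_eq_mk.symm
  set pt : ℕ → E3 → E3 := fun n s =>
    chart s₀ l (dyadicPt n (dyadicCeil n (chartInv s₀ l s))) with hpt
  set Z' : E3 → Ω → ℝ := fun s ω => limsup (fun n => W (pt n s) ω) atTop with hZ'
  have hWZd : ∀ᵐ ω ∂P, ∀ x ∈ dyadicCube (Fin 3), W (chart s₀ l x) ω = Z (chart s₀ l x) ω :=
    (ae_ball_iff (countable_dyadicCube (Fin 3))).2 fun x hx =>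
      hWZ _ (hmem x (mem_unit_of_mem_dyadicCube hx))
  have hgood : ∀ᵐ ω ∂P, ∃ g : (Fin 3 → ℝ) → ℝ, ContDiffOn ℝ 1 g (openCube (Fin 3)) ∧
      ∀ s ∈ U, Tendsto (fun n => W (pt n s) ω) atTop (𝓝 (g (chartInv s₀ l s))) := by
    filter_upwards [hWZd, hZ.ae_uniformContinuousOn hν ha hl hcS,
      ae_all_iff.2 (hZ.ae_uniformContinuousOn_quotientFun hν ha hl hcS)] with ω h1 h2 h3
    obtain ⟨g, hg, hlim⟩ := exists_contDiffOn_of_uniformContinuousOn h2 h3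
    refine ⟨g, hg, fun s hs => (hlim _ hs).congr fun n => ?_⟩
    exact (h1 _ (dyadicPt_dyadicCeil_mem (hunit _ hs) n)).symm
  refine ⟨U, hUo, hpl, Z', fun s => Measurable.limsup fun n => hWm _, fun s hs => ?_, ?_⟩
  · -- the dyadic values converge in `L²` to the value of the field
    have hsS : s ∈ S := by
      have := hmem _ (hunit _ hs)
      rwa [chart_chartInv s₀ hl.ne'] at this
    have hptS : ∀ n, pt n s ∈ S := fun n =>
      hmem _ (mem_unit_of_mem_dyadicCube (dyadicPt_dyadicCeil_mem (hunit _ hs) n))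
    have hptlim : Tendsto (fun n => ‖pt n s - s‖) atTop (𝓝 0) := by
      have h1 : Tendsto (fun n => 2 * l *
          dist (dyadicPt n (dyadicCeil n (chartInv s₀ l s))) (chartInv s₀ l s)) atTop (𝓝 0) := by
        have := (tendsto_iff_dist_tendsto_zero.1
          (tendsto_dyadicPt_dyadicCeil (chartInv s₀ l s))).const_mul (2 * l)
        rwa [mul_zero] at this
      refine squeeze_zero (fun n => norm_nonneg _) (fun n => ?_) h1
      have := norm_chart_sub_le s₀ hl.le (dyadicPt n (dyadicCeil n (chartInv s₀ l s)))
        (chartInv s₀ l s)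
      rwa [chart_chartInv s₀ hl.ne'] at this
    set C := √(∫ ξ, ‖ξ‖ ^ (2 * (1 : ℝ)) ∂maternSpectral E3 ν a) with hC
    have hL2 : Tendsto (fun n => eLpNorm (W (pt n s) - Z s) 2 P) atTop (𝓝 0) := by
      have h0 : Tendsto (fun n => ENNReal.ofReal (C * (2 * ‖pt n s - s‖ ^ (1 : ℝ)))) atTop
          (𝓝 0) := by
        have h1 := ((hptlim.const_mul 2).const_mul C)
        rw [mul_zero, mul_zero] at h1
        have h2 := (ENNReal.continuous_ofReal.tendsto 0).comp h1
        rw [ENNReal.ofReal_zero] at h2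
        simpa [Function.comp_def] using h2
      refine tendsto_of_tendsto_of_tendsto_of_le_of_le tendsto_const_nhds h0
        (fun n => zero_le) fun n => ?_
      have h1 : W (pt n s) - Z s =ᵐ[P] Z (pt n s) - Z s := (hWZ _ (hptS n)).sub (ae_eq_refl _)
      rw [eLpNorm_congr_ae h1]
      exact eLpNorm_two_le_of_integral_sq_le ((hZ.memLp_two (hptS n)).sub (hZ.memLp_two hsS))
        (by positivity) (hZ.integral_sq_sub_le hν0 ha zero_le_one le_rfl hν (hptS n) hsS)
    obtain ⟨ns, hns, hae⟩ := (tendstoInMeasure_of_tendsto_eLpNorm two_ne_zero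
      (fun n => (hWm (pt n s)).aestronglyMeasurable) (hZ.memLp_two hsS).1
      hL2).exists_seq_tendsto_ae
    filter_upwards [hgood, hae] with ω hω1 hω2
    obtain ⟨g, -, hlim⟩ := hω1
    have h1 := hlim s hs
    rw [hZ']
    beta_reduce
    rw [h1.limsup_eq]
    exact tendsto_nhds_unique (h1.comp hns.tendsto_atTop) hω2
  · filter_upwards [hgood] with ω hω
    obtain ⟨g, hg, hlim⟩ := hω
    refine (hg.comp (contDiff_chartInv s₀ l).contDiffOn fun s hs => hs).congr fun s hs => ?_
    exact (hlim s hs).limsup_eq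

end IsMaternField

/-! ### Gluing local versions -/

/-- A field which locally has continuously differentiable versions has one globally: by continuity,
countably many local versions almost surely agree on all overlaps. -/
theorem exists_version_of_local {Ω : Type*} [MeasurableSpace Ω] {P : Measure Ω} {S : Set E3}
    {Z : E3 → Ω → ℝ}
    (h : ∀ p ∈ S, ∃ U : Set E3, IsOpen U ∧ p ∈ U ∧ ∃ Z' : E3 → Ω → ℝ, (∀ s, Measurable (Z' s)) ∧
      (∀ s ∈ U, Z' s =ᵐ[P] Z s) ∧ ∀ᵐ ω ∂P, ContDiffOn ℝ 1 (fun s => Z' s ω) U) :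
    ∃ Z' : E3 → Ω → ℝ, (∀ s, Measurable (Z' s)) ∧
      (∀ s ∈ S, Z' s =ᵐ[P] Z s) ∧ ∀ᵐ ω ∂P, ContDiffOn ℝ 1 (fun s => Z' s ω) S := by
  classical
  choose! U hUo hpU V hVm hVZ hVc using h
  obtain ⟨T, hT, hTU⟩ := TopologicalSpace.isOpen_iUnion_countable (fun p : S => U p)
    fun p => hUo p p.2
  have hcover : ∀ s ∈ S, ∃ p ∈ T, s ∈ U p := by
    intro s hs
    have h1 : s ∈ ⋃ p : S, U p := Set.mem_iUnion.2 ⟨⟨s, hs⟩, hpU s hs⟩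
    rw [← hTU] at h1
    simpa using h1
  set Z' : E3 → Ω → ℝ := fun s =>
    if hs : ∃ p ∈ T, s ∈ U p then V (hs.choose : S) s else 0 with hZ'
  have hZV : ∀ s, ∀ p ∈ T, s ∈ U p → ∃ q ∈ T, s ∈ U q ∧ Z' s = V q s := by
    intro s p hp hsp
    have hs : ∃ p ∈ T, s ∈ U p := ⟨p, hp, hsp⟩
    exact ⟨hs.choose, hs.choose_spec.1, hs.choose_spec.2, by simp only [hZ', dif_pos hs]⟩
  have hagree : ∀ᵐ ω ∂P, ∀ p ∈ T, ∀ q ∈ T, ∀ s ∈ U p ∩ U q, V p s ω = V q s ω := by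
    have h1 : ∀ p ∈ T, ∀ᵐ ω ∂P, ∀ q ∈ T, ∀ s ∈ U p ∩ U q, V p s ω = V q s ω := by
      intro p hp
      refine (ae_ball_iff hT).2 fun q hq => ?_
      have h2 : ∀ᵐ ω ∂P, ∀ n, TopologicalSpace.denseSeq E3 n ∈ U p ∩ U q →
          V p (TopologicalSpace.denseSeq E3 n) ω = V q (TopologicalSpace.denseSeq E3 n) ω := by
        refine ae_all_iff.2 fun n => ?_
        by_cases hn : TopologicalSpace.denseSeq E3 n ∈ U p ∩ U q
        · filter_upwards [hVZ p p.2 _ hn.1, hVZ q q.2 _ hn.2] with ω e1 e2 _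
          rw [e1, e2]
        · exact ae_of_all _ fun ω h => absurd h hn
      filter_upwards [h2, hVc p p.2, hVc q q.2] with ω e1 e2 e3
      have hd := (TopologicalSpace.denseRange_denseSeq E3).open_subset_closure_inter
        ((hUo p p.2).inter (hUo q q.2))
      refine Set.EqOn.of_subset_closure
        (s := (U p ∩ U q) ∩ Set.range (TopologicalSpace.denseSeq E3)) ?_
        (e2.continuousOn.mono Set.inter_subset_left)
        (e3.continuousOn.mono Set.inter_subset_right) Set.inter_subset_left hd
      rintro _ ⟨hs, n, rfl⟩
      exact e1 n hs
    exact (ae_ball_iff hT).2 h1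
  have hVcT : ∀ᵐ ω ∂P, ∀ p ∈ T, ContDiffOn ℝ 1 (fun s => V p s ω) (U p) :=
    (ae_ball_iff hT).2 fun p _ => hVc p p.2
  refine ⟨Z', fun s => ?_, fun s hs => ?_, ?_⟩
  · by_cases hs : ∃ p ∈ T, s ∈ U p
    · simp only [hZ', dif_pos hs]
      exact hVm _ hs.choose.2 s
    · simp only [hZ', dif_neg hs]
      exact measurable_const
  · obtain ⟨p, hp, hsp⟩ := hcover s hs
    obtain ⟨q, hq, hsq, he⟩ := hZV s p hp hsp
    rw [he]
    exact hVZ q q.2 s hsq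
  · filter_upwards [hagree, hVcT] with ω h1 h2 s hs
    obtain ⟨p, hp, hsp⟩ := hcover s hs
    have h3 : ContDiffAt ℝ 1 (fun s => V p s ω) s := (h2 p hp).contDiffAt ((hUo p p.2).mem_nhds hsp)
    refine (h3.congr_of_eventuallyEq ?_).contDiffWithinAt
    filter_upwards [(hUo p p.2).mem_nhds hsp] with t ht
    obtain ⟨q, hq, htq, he⟩ := hZV t p hp ht
    rw [he]
    exact h1 q hq p hp t ⟨htq, ht⟩

/-! ### Sufficiency of `ν > 1` -/

namespace IsMaternField

variable {Ω : Type*} [MeasurableSpace Ω] {P : Measure Ω} {S : Set E3} {ν a : ℝ} {Z : E3 → Ω → ℝ}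

theorem exists_eLpNorm_quotient_sub_le (hZ : IsMaternField P S ν a Z) (hν : 0 < ν) (ha : 0 < a)
    {α : ℝ} (hα : 0 ≤ α) (hα1 : α ≤ 1) (hαν : 1 + α < ν) {s u : E3} (hu : ‖u‖ = 1) (hs : s ∈ S) :
    ∃ C : ℝ, ∀ h k : ℝ, h ≠ 0 → k ≠ 0 → s + h • u ∈ S → s + k • u ∈ S →
      eLpNorm (fun ω => (Z (s + h • u) ω - Z s ω) / h - (Z (s + k • u) ω - Z s ω) / k) 2 P
        ≤ ENNReal.ofReal (C * |h - k| ^ α) := by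
  refine ⟨√(∫ ξ, ‖ξ‖ ^ (2 * (1 + α)) ∂maternSpectral E3 ν a) * 2,
    fun h k hh hk hsh hsk => ?_⟩
  have hL := (hZ.hasGaussianLaw_quotient_sub (h := h) (k := k) hs hsh hs hsk).memLp_two
  have hI := hZ.integral_sq_quotient_sub_le hν ha hα hα1 hαν hu hh hk hs hsh hs hsk
  rw [sub_self, norm_zero, zero_add, ← mul_assoc] at hI
  have hC := Real.sqrt_nonneg (∫ ξ, ‖ξ‖ ^ (2 * (1 + α)) ∂maternSpectral E3 ν a)
  have hp : 0 ≤ |h - k| ^ α := Real.rpow_nonneg (abs_nonneg _) _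
  exact eLpNorm_two_le_of_integral_sq_le hL (mul_nonneg (mul_nonneg hC zero_le_two) hp) hI

/-- If the difference quotients of a measurable version converge almost surely along some sequence
of increments tending to zero, then those of the field converge in `L²` to the same limit along all
increments: Fatou's lemma applied to the Hölder bound between two increments. -/
theorem tendsto_eLpNorm_quotient (hZ : IsMaternField P S ν a Z) (hν : 1 < ν) (ha : 0 < a)
    (hS : IsOpen S) {s u : E3} (hs : s ∈ S) (hu : ‖u‖ = 1) {Z' : E3 → Ω → ℝ}
    (hZ'm : ∀ s, Measurable (Z' s)) (hZ' : ∀ s ∈ S, Z' s =ᵐ[P] Z s) {k : ℕ → ℝ}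
    (hk : Tendsto k atTop (𝓝[≠] 0)) {D : Ω → ℝ}
    (hD : ∀ᵐ ω ∂P, Tendsto (fun n => (Z' (s + k n • u) ω - Z' s ω) / k n) atTop (𝓝 (D ω))) :
    Tendsto (fun h : ℝ => eLpNorm (fun ω => (Z (s + h • u) ω - Z s ω) / h - D ω) 2 P)
      (𝓝[≠] 0) (𝓝 0) := by
  have hν0 : 0 < ν := by linarith
  obtain ⟨α, hα, hα1, hαν⟩ : ∃ α : ℝ, 0 < α ∧ α ≤ 1 ∧ 1 + α < ν :=
    ⟨min ((ν - 1) / 2) 1, lt_min (by linarith) one_pos, min_le_right _ _, by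
      have := min_le_left ((ν - 1) / 2) 1
      linarith⟩
  obtain ⟨C, hC⟩ := hZ.exists_eLpNorm_quotient_sub_le hν0 ha hα.le hα1 hαν hu hs
  have hline : ∀ᶠ h in 𝓝[≠] (0 : ℝ), s + h • u ∈ S := by
    have hc : Continuous fun h : ℝ => s + h • u := by fun_prop
    have := hc.tendsto 0
    rw [zero_smul, add_zero] at this
    exact nhdsWithin_le_nhds (this (hS.mem_nhds hs))
  have hne : ∀ᶠ h in 𝓝[≠] (0 : ℝ), h ≠ 0 := self_mem_nhdsWithin
  have hk0 : Tendsto k atTop (𝓝 0) := hk.mono_right nhdsWithin_le_nhds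
  have hbound : ∀ᶠ h in 𝓝[≠] (0 : ℝ),
      eLpNorm (fun ω => (Z (s + h • u) ω - Z s ω) / h - D ω) 2 P
        ≤ ENNReal.ofReal (C * |h| ^ α) := by
    filter_upwards [hline, hne] with h hsh hh
    set Q : ℕ → Ω → ℝ := fun n ω =>
      (Z (s + h • u) ω - Z s ω) / h - (Z' (s + k n • u) ω - Z' s ω) / k n with hQ
    have hQm : ∀ n, AEStronglyMeasurable (Q n) P := fun n =>
      ((((hZ.aemeasurable hsh).sub (hZ.aemeasurable hs)).div_const _).sub
        (((hZ'm _).sub (hZ'm _)).div_const _).aemeasurable).aestronglyMeasurable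
    have hlim : ∀ᵐ ω ∂P, Tendsto (fun n => Q n ω) atTop
        (𝓝 ((Z (s + h • u) ω - Z s ω) / h - D ω)) := by
      filter_upwards [hD] with ω hω
      exact tendsto_const_nhds.sub hω
    refine (Lp.eLpNorm_lim_le_liminf_eLpNorm hQm _ hlim).trans ?_
    have hev : ∀ᶠ n in atTop, eLpNorm (Q n) 2 P ≤
        ENNReal.ofReal (C * |h - k n| ^ α) := by
      filter_upwards [hk.eventually hline, hk.eventually hne] with n hsk hkn
      have hQZ : Q n =ᵐ[P] fun ω =>
          (Z (s + h • u) ω - Z s ω) / h - (Z (s + k n • u) ω - Z s ω) / k n := by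
        filter_upwards [hZ' _ hsk, hZ' _ hs] with ω e1 e2
        simp only [hQ, e1, e2]
      rw [eLpNorm_congr_ae hQZ]
      exact hC h (k n) hh hkn hsh hsk
    have hconv : Tendsto (fun n => ENNReal.ofReal (C * |h - k n| ^ α)) atTop
        (𝓝 (ENNReal.ofReal (C * |h| ^ α))) := by
      have h1 : Tendsto (fun n => |h - k n|) atTop (𝓝 |h|) := by
        have h2 : Tendsto (fun n => |h - k n|) atTop (𝓝 |h - 0|) := (hk0.const_sub h).abs
        rwa [sub_zero] at h2
      have h2 : Tendsto (fun n => |h - k n| ^ α) atTop (𝓝 (|h| ^ α)) :=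
        h1.rpow_const (Or.inr hα.le)
      exact ENNReal.tendsto_ofReal (h2.const_mul C)
    exact (liminf_le_liminf hev).trans hconv.liminf_eq.le
  have hzero : Tendsto (fun h : ℝ => ENNReal.ofReal (C * |h| ^ α)) (𝓝[≠] 0) (𝓝 0) := by
    have h1 : Tendsto (fun h : ℝ => |h| ^ α) (𝓝 0) (𝓝 0) := by
      have := (continuous_abs.tendsto (0 : ℝ)).rpow_const (p := α) (Or.inr hα.le)
      simpa [Real.zero_rpow hα.ne'] using this
    have h2 := h1.const_mul C
    rw [mul_zero] at h2
    have h3 := (ENNReal.continuous_ofReal.tendsto 0).comp h2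
    rw [ENNReal.ofReal_zero] at h3
    exact h3.mono_left nhdsWithin_le_nhds
  exact tendsto_of_tendsto_of_tendsto_of_le_of_le' tendsto_const_nhds hzero
    (.of_forall fun h => zero_le) hbound

theorem conditionA1 (hZ : IsMaternField P S ν a Z) (hν : 1 < ν) (ha : 0 < a) (hS : IsOpen S) :
    ConditionA1 P S Z := by
  obtain ⟨Z', hZ'm, hZ', hZ'c⟩ :=
    exists_version_of_local fun p hp => hZ.exists_local_version hν ha hS hp
  set k : ℕ → ℝ := fun n => 1 / ((n : ℝ) + 1) with hkd
  have hk : Tendsto k atTop (𝓝[≠] 0) :=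
    tendsto_nhdsWithin_iff.2 ⟨tendsto_one_div_add_atTop_nhds_zero_nat, .of_forall fun n =>
      (show (0 : ℝ) < 1 / ((n : ℝ) + 1) by positivity).ne'⟩
  set D : Fin 3 → E3 → Ω → ℝ := fun i s ω =>
    limsup (fun n => (Z' (s + k n • e i) ω - Z' s ω) / k n) atTop with hD
  have hline : ∀ i, ∀ s ∈ S, ∀ᵐ ω ∂P, HasLineDerivAt ℝ (fun x => Z' x ω) (D i s ω) s (e i) ∧
      Tendsto (fun n => (Z' (s + k n • e i) ω - Z' s ω) / k n) atTop (𝓝 (D i s ω)) := by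
    intro i s hs
    filter_upwards [hZ'c] with ω hω
    have h1 : DifferentiableAt ℝ (fun x => Z' x ω) s :=
      (hω.contDiffAt (hS.mem_nhds hs)).differentiableAt (by norm_num)
    have h2 := h1.hasFDerivAt.hasLineDerivAt (e i)
    have h3 : Tendsto (fun n => (Z' (s + k n • e i) ω - Z' s ω) / k n) atTop
        (𝓝 (fderiv ℝ (fun x => Z' x ω) s (e i))) := by
      refine (h2.tendsto_slope_zero.comp hk).congr fun n => ?_
      simp [div_eq_inv_mul]
    have h4 : D i s ω = fderiv ℝ (fun x => Z' x ω) s (e i) := h3.limsup_eq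
    rw [h4]
    exact ⟨h2, h3⟩
  refine ⟨D, fun i s hs => ⟨?_, ?_⟩, Z', ⟨fun s _ => hZ'm s, hZ', hZ'c⟩, fun i s hs =>
    (hline i s hs).mono fun ω h => h.1⟩
  · exact Measurable.limsup fun n => ((hZ'm _).sub (hZ'm _)).div_const _
  · exact hZ.tendsto_eLpNorm_quotient hν ha hS hs (norm_e i) hZ'm hZ' hk
      ((hline i s hs).mono fun ω h => h.2)

theorem conditionA2 (hZ : IsMaternField P S ν a Z) (hν : 1 < ν) (ha : 0 < a) :
    ConditionA2 P S Z :=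
  ⟨fun h => matern ν a ‖h‖, ⟨fun _ hs => hZ.memLp_two hs, ⟨0, hZ.mean_eq_zero⟩, hZ.cov_eq⟩,
    (contDiff_matern_norm hν ha).contDiffOn⟩

end IsMaternField

end MaternField

theorem mainTheorem4 {Ω : Type*} [MeasurableSpace Ω] (P : Measure Ω) [IsProbabilityMeasure P]
    (ε : ℝ) (hε : 0 < ε) (ν a : ℝ) (hν : 0 < ν) (ha : 0 < a)
    (Z : MaternField.E3 → Ω → ℝ)
    (hgauss : IsGaussianProcess (fun s : MaternField.shell ε => Z s) P)
    (hmean : ∀ s ∈ MaternField.shell ε, ∫ ω, Z s ω ∂P = 0)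
    (hcov : ∀ s ∈ MaternField.shell ε, ∀ t ∈ MaternField.shell ε,
      cov[Z s, Z t; P] = MaternField.matern ν a ‖s - t‖) :
    ((MaternField.ConditionA1 P (MaternField.shell ε) Z ∧
        MaternField.ConditionA2 P (MaternField.shell ε) Z) ↔ 1 < ν) ∧
    (1 < ν →
      ContDiffOn ℝ 2 (MaternField.matern ν a) (Set.Ici 0) ∧
      ContDiff ℝ 2 (fun h : MaternField.E3 => MaternField.matern ν a ‖h‖) ∧
      MaternField.hessian (fun h : MaternField.E3 => MaternField.matern ν a ‖h‖) 0
        = MaternField.radialF (MaternField.matern ν a) 0 • (1 : Matrix (Fin 3) (Fin 3) ℝ) ∧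
      MaternField.radialF (MaternField.matern ν a) 0 = -a ^ 2 / (2 * (ν - 1))) := by
  have hZ : MaternField.IsMaternField P (MaternField.shell ε) ν a Z := ⟨hgauss, hmean, hcov⟩
  refine ⟨⟨fun h => MaternField.one_lt_of_conditionA2 hε hν ha hcov h.2, fun h1 =>
    ⟨hZ.conditionA1 h1 ha (MaternField.isOpen_shell ε), hZ.conditionA2 h1 ha⟩⟩, fun h1 =>
    ⟨MaternField.contDiffOn_matern h1 ha, MaternField.contDiff_matern_norm h1 ha,
      MaternField.hessian_matern h1 ha, ?_⟩⟩
  rw [MaternField.radialF_matern_zero h1 ha, MaternField.deriv_deriv_matern_abs h1 ha]
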